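/- Let $m$ be normalized Lebesgue measure on the unit circle $\mathbb T$, and let $\mu=w\,dm+\mu_s$ be a probability measure on $\mathbb T$ (with $\mu_s$ singular to $m$) in the Szegő class, i.e. $\log w\in L^1(m)$. For $z$ in the open unit disk $\mathbb D$ put $$\mathcal K(\mu,z)=\log\int_{\mathbb T}\frac{1-|z|^2}{|1-\bar\xi z|^2}\,d\mu(\xi)-\int_{\mathbb T}\frac{1-|z|^2}{|1-\bar\xi z|^2}\,\log w(\xi)\,dm(\xi).$$ The Schur family $\{f_n\}_{n\ge 0}$ of $\mu$ consists of the analytic functions in $\mathbb D$ determined by $$\frac{1+zf_0(z)}{1-zf_0(z)}=\int_{\mathbb T}\frac{1+\bar\xi z}{1-\bar\xi z}\,d\mu(\xi),\qquad zf_{n+1}(z)=\frac{f_n(z)-f_n(0)}{1-\overline{f_n(0)}f_n(z)}\qquad(z\in\mathbb D,\ n\ge 0).$$ Then the Schur family exists, and for every $z\in\mathbb D$ one has $|f_n(z)|<1$ for all $n$, the product below converges, and $$\mathcal K(\mu,z)=\log\prod_{n\ge 0}\frac{1-|zf_n(z)|^2}{1-|f_n(z)|^2}.$$ -/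

import Mathlib

open MeasureTheory

noncomputable section

namespace SzegoEntropy

instance circleMeasurableSpace : MeasurableSpace Circle := borel Circle

instance circleBorelSpace : BorelSpace Circle := ⟨rfl⟩

/-- Lebesgue measure on the unit circle `𝕋`, normalized to have total mass one: the image of
`dθ / (2π)` on `(0, 2π]` under `θ ↦ exp (iθ)`. -/
def circleLebesgue : Measure Circle :=
  (ENNReal.ofReal (2 * Real.pi)⁻¹ • volume.restrict (Set.Ioc 0 (2 * Real.pi))).map Circle.exp

instance circleLebesgue_isProbabilityMeasure : IsProbabilityMeasure circleLebesgue := by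
  refine ⟨?_⟩
  have hpi := Real.two_pi_pos
  rw [circleLebesgue, Measure.map_apply Circle.exp.continuous.measurable MeasurableSet.univ]
  simp only [Set.preimage_univ, Measure.smul_apply, Measure.restrict_apply_univ, Real.volume_Ioc,
    sub_zero, smul_eq_mul]
  rw [← ENNReal.ofReal_mul (by positivity), inv_mul_cancel₀ hpi.ne', ENNReal.ofReal_one]

/-- The density `w` of the absolutely continuous part of `μ = w dm + μₛ`. -/
def density (μ : Measure Circle) (ξ : Circle) : ℝ :=
  (μ.rnDeriv circleLebesgue ξ).toReal

/-- The Szegő class: probability measures on the circle such that `log w ∈ L¹(m)`. Since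
`Real.log 0 = 0`, the requirement that `log w` be finite almost everywhere is stated separately. -/
structure IsSzego (μ : Measure Circle) : Prop where
  isProbabilityMeasure : IsProbabilityMeasure μ
  density_pos : ∀ᵐ ξ ∂circleLebesgue, 0 < density μ ξ
  integrable_log : Integrable (fun ξ => Real.log (density μ ξ)) circleLebesgue

/-- The Poisson kernel `(1 - |z|²) / |1 - ξ̄ z|²` of the unit disk. -/
def diskPoissonKernel (z : ℂ) (ξ : Circle) : ℝ :=
  (1 - ‖z‖ ^ 2) / ‖1 - (starRingEnd ℂ) (ξ : ℂ) * z‖ ^ 2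

/-- The harmonic extension `P(μ, z)` of a measure on the circle. -/
def poissonOfMeasure (μ : Measure Circle) (z : ℂ) : ℝ :=
  ∫ ξ, diskPoissonKernel z ξ ∂μ

/-- The harmonic extension `P(v, z) = P(v dm, z)` of a function `v ∈ L¹(m)`. -/
def poissonOfFun (v : Circle → ℝ) (z : ℂ) : ℝ :=
  ∫ ξ, diskPoissonKernel z ξ * v ξ ∂circleLebesgue

/-- The entropy function `K(μ, z) = log P(μ, z) - P(log w, z)`. -/
def entropy (μ : Measure Circle) (z : ℂ) : ℝ :=
  Real.log (poissonOfMeasure μ z) - poissonOfFun (fun ξ => Real.log (density μ ξ)) z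

/-- `f` is (a function on `ℂ` whose restriction to the open unit disk is) the Schur function
of `μ`: it is analytic in the disk and
`(1 + z f(z)) / (1 - z f(z)) = ∫ (1 + ξ̄ z) / (1 - ξ̄ z) dμ(ξ)` there. -/
structure IsSchurFunction (μ : Measure Circle) (f : ℂ → ℂ) : Prop where
  analytic : AnalyticOnNhd ℂ f (Metric.ball 0 1)
  relation : ∀ z ∈ Metric.ball (0 : ℂ) 1,
    (1 + z * f z) / (1 - z * f z) =
      ∫ ξ : Circle, (1 + (starRingEnd ℂ) (ξ : ℂ) * z) / (1 - (starRingEnd ℂ) (ξ : ℂ) * z) ∂μ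

/-- `{f_n}` is the Schur family of `μ`: `f_0` is the Schur function of `μ`, all `f_n` are analytic
in the open unit disk, and the Schur algorithm
`z f_{n+1}(z) = (f_n(z) - f_n(0)) / (1 - conj(f_n(0)) f_n(z))` holds there. -/
structure IsSchurFamily (μ : Measure Circle) (f : ℕ → ℂ → ℂ) : Prop where
  zero : IsSchurFunction μ (f 0)
  analytic : ∀ n, AnalyticOnNhd ℂ (f n) (Metric.ball 0 1)
  step : ∀ n, ∀ z ∈ Metric.ball (0 : ℂ) 1,
    z * f (n + 1) z = (f n z - f n 0) / (1 - (starRingEnd ℂ) (f n 0) * f n z)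

end SzegoEntropy

end

/-! Put `a_n = f_n(0)`, let `Φ_n`, `Φ_n^*` be the polynomials of Szegő's recurrence with these
parameters, `S_n = ∏_{k<n} (1 - |a_k|²)`, and `w_n = S_n / |Φ_n^*|²` on the circle. Undoing `n`
steps of the Schur algorithm gives the exact identity (`IsSchurFamily.prod_schurFactor`) `∏_{k<n} (1
- |z f_k|²)/(1 - |f_k|²) · (1 - |z f_n|²) · S_n = P(μ, z) |Φ_n^*(z) - z Φ_n(z) f_n(z)|²`. Since
`|Φ_n| ≤ |Φ_n^*|` in the disk, the partial product is `P(μ, z) |Φ_n^*(z)|² / S_n` up to a factor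
between `(1 - r)/(1 + r)` and its inverse, where `r = |z f_n(z)| ≤ |z|`. Boundedness of `|Φ_n^*(z)|²
/ S_n` bounds the partial products; as each factor is at least `1 + (1 - |z|²)|f_n(z)|²`, the
product converges, `f_n(z) → 0`, and the correcting factor tends to one.

It remains to find the limit of `|Φ_n^*(z)|² / S_n`. Because `Φ_n^*` has no zeros in the closed
disk, its logarithm is `-P(log w_n, z)`, so the claim becomes `P(log w_n, z) → P(log w, z)`. The
measure `w_n dm` has the same moments as `μ` up to order `n` (`IsSchurPrefix.moment_eq`). This has
two consequences. First, `∫ |Φ_n^*|² dμ = S_n`, that is, `∫ w / w_n dm ≤ 1`. Secondly, a positive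
trigonometric polynomial `T` close to `1/w` has the same integral against `μ` and `w_n dm` for large
`n`, and `log (w_n T) ≤ w_n T - 1` yields `limsup ∫ log w_n ≤ ∫ log w`. So `x_n = log (w / w_n)`
satisfies `∫ exp x_n ≤ 1` and `liminf ∫ x_n ≥ 0`; the nonnegative function `exp x_n - 1 - x_n` then
has integral tending to zero, and it controls `|x_n|` up to an arbitrarily small constant.

Existence of the family, and `|f_n| < 1`, rest on excluding `|a_n| = 1`: otherwise `∫ |Φ_{n+1}^*|²
dμ = 0`, so `Φ_{n+1}^*` vanishes almost everywhere on the circle although its mean is `Φ_{n+1}^*(0)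
= 1`. -/

noncomputable section

open scoped ComplexConjugate Topology
open Filter

namespace SzegoEntropy

/-! ### Mean value, Cauchy and Poisson formulas on the circle -/

section CircleIntegrals

@[simp]
theorem norm_coe_circle (ξ : Circle) : ‖(ξ : ℂ)‖ = 1 := Circle.norm_coe ξ

@[fun_prop]
theorem continuous_coe_circle : Continuous fun ξ : Circle => (ξ : ℂ) := continuous_subtype_val

theorem integral_circleLebesgue_eq_circleAverage {E : Type*} [NormedAddCommGroup E]
    [NormedSpace ℝ E] {G : ℂ → E} (hG : Continuous fun ξ : Circle => G ξ) :
    ∫ ξ : Circle, G ξ ∂circleLebesgue = Real.circleAverage G 0 1 := by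
  have hpi := Real.two_pi_pos
  rw [circleLebesgue, integral_map Circle.exp.continuous.aemeasurable
    hG.aestronglyMeasurable, integral_smul_measure, Real.circleAverage_def,
    intervalIntegral.integral_of_le hpi.le, ENNReal.toReal_ofReal (by positivity)]
  simp [circleMap]

theorem continuous_coe_circle_comp {E : Type*} [TopologicalSpace E] {G : ℂ → E}
    (hG : ContinuousOn G (Metric.closedBall 0 1)) : Continuous fun ξ : Circle => G ξ :=
  hG.comp_continuous continuous_coe_circle fun ξ => by simp

theorem one_sub_conj_mul_ne_zero {z : ℂ} (hz : ‖z‖ < 1) (ξ : Circle) : 1 - conj (ξ : ℂ) * z ≠ 0 := by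
  intro h
  have : ‖conj (ξ : ℂ) * z‖ = 1 := by rw [← sub_eq_zero.mp h]; simp
  simp at this
  linarith

theorem conj_coe_circle_mul_self (ξ : Circle) : conj (ξ : ℂ) * ξ = 1 := by
  rw [mul_comm, Complex.mul_conj, Circle.normSq_coe]; simp

variable {G : ℂ → ℂ}

theorem diffContOnCl_of_analyticOnNhd (hG : AnalyticOnNhd ℂ G (Metric.closedBall 0 1)) :
    DiffContOnCl ℂ G (Metric.ball 0 1) :=
  DifferentiableOn.diffContOnCl (by
    rw [closure_ball _ one_ne_zero]; exact hG.differentiableOn)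

theorem integral_circleLebesgue_eq_apply_zero (hG : AnalyticOnNhd ℂ G (Metric.closedBall 0 1)) :
    ∫ ξ : Circle, G ξ ∂circleLebesgue = G 0 := by
  rw [integral_circleLebesgue_eq_circleAverage (continuous_coe_circle_comp hG.continuousOn)]
  exact DiffContOnCl.circleAverage (by simpa using diffContOnCl_of_analyticOnNhd hG)

theorem integral_cauchyKernel_mul (hG : AnalyticOnNhd ℂ G (Metric.closedBall 0 1)) {z : ℂ}
    (hz : ‖z‖ < 1) :
    ∫ ξ : Circle, (1 - conj (ξ : ℂ) * z)⁻¹ * G ξ ∂circleLebesgue = G z := by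
  have key : ∀ ξ : Circle, (1 - conj (ξ : ℂ) * z)⁻¹ * G ξ = ((ξ : ℂ) / (ξ - z)) • G ξ := by
    intro ξ
    have h1 := one_sub_conj_mul_ne_zero hz ξ
    have h2 : (ξ : ℂ) - z = ξ * (1 - conj (ξ : ℂ) * z) := by
      linear_combination z * conj_coe_circle_mul_self ξ
    rw [h2, smul_eq_mul, div_mul_cancel_left₀ (Circle.coe_ne_zero ξ)]
  have hc := continuous_coe_circle_comp hG.continuousOn
  have hcont : Continuous fun ξ : Circle => (1 - conj (ξ : ℂ) * z)⁻¹ * G ξ :=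
    (Continuous.inv₀ (by fun_prop) (one_sub_conj_mul_ne_zero hz)).mul hc
  simp_rw [key] at hcont ⊢
  rw [integral_circleLebesgue_eq_circleAverage (G := fun ξ => (ξ / (ξ - z)) • G ξ) hcont]
  have := DiffContOnCl.circleAverage_smul_div (f := G) (c := 0) (R := 1) (w := z)
    (by simpa using diffContOnCl_of_analyticOnNhd hG) (by simpa using hz)
  simpa using this

theorem diskPoissonKernel_eq (z : ℂ) (ξ : Circle) :
    diskPoissonKernel z ξ = poissonKernel 0 z ξ := by
  have h2 : (ξ : ℂ) - z = ξ * (1 - conj (ξ : ℂ) * z) := by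
    linear_combination z * conj_coe_circle_mul_self ξ
  simp only [diskPoissonKernel, poissonKernel, sub_zero, h2]
  simp

theorem continuous_diskPoissonKernel {z : ℂ} (hz : ‖z‖ < 1) : Continuous (diskPoissonKernel z) := by
  refine Continuous.div (by fun_prop) (by fun_prop) fun ξ => ?_
  simpa using one_sub_conj_mul_ne_zero hz ξ

theorem integral_diskPoissonKernel_mul (hG : AnalyticOnNhd ℂ G (Metric.closedBall 0 1)) {z : ℂ}
    (hz : ‖z‖ < 1) :
    ∫ ξ : Circle, (diskPoissonKernel z ξ : ℂ) * G ξ ∂circleLebesgue = G z := by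
  have hcont : Continuous fun ξ : Circle => (diskPoissonKernel z ξ : ℂ) * G ξ :=
    (Complex.continuous_ofReal.comp (continuous_diskPoissonKernel hz)).mul
      (continuous_coe_circle_comp hG.continuousOn)
  simp_rw [diskPoissonKernel_eq] at hcont ⊢
  rw [integral_circleLebesgue_eq_circleAverage (G := fun ξ => (poissonKernel 0 z ξ : ℂ) * G ξ) hcont]
  have := DiffContOnCl.circleAverage_poissonKernel_smul (f := G) (c := 0) (R := 1) (w := z)
    (diffContOnCl_of_analyticOnNhd hG) (by simpa using hz)
  rw [← this]
  congr 1

theorem integral_diskPoissonKernel_mul_re (hG : AnalyticOnNhd ℂ G (Metric.closedBall 0 1)) {z : ℂ}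
    (hz : ‖z‖ < 1) :
    ∫ ξ : Circle, diskPoissonKernel z ξ * (G ξ).re ∂circleLebesgue = (G z).re := by
  have hcont : Continuous fun ξ : Circle => (diskPoissonKernel z ξ : ℂ) * G ξ :=
    (Complex.continuous_ofReal.comp (continuous_diskPoissonKernel hz)).mul
      (continuous_coe_circle_comp hG.continuousOn)
  rw [← integral_diskPoissonKernel_mul hG hz]
  have := integral_re (𝕜 := ℂ) (μ := circleLebesgue)
    (hcont.integrable_of_hasCompactSupport (HasCompactSupport.of_compactSpace _))
  simpa using this

theorem integral_re_circleLebesgue (hG : AnalyticOnNhd ℂ G (Metric.closedBall 0 1)) :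
    ∫ ξ : Circle, (G ξ).re ∂circleLebesgue = (G 0).re := by
  have := integral_diskPoissonKernel_mul_re hG (z := 0) (by simp)
  simpa [diskPoissonKernel] using this

theorem diskPoissonKernel_bounds {z : ℂ} (hz : ‖z‖ < 1) (ξ : Circle) :
    (1 - ‖z‖) / (1 + ‖z‖) ≤ diskPoissonKernel z ξ ∧
      diskPoissonKernel z ξ ≤ (1 + ‖z‖) / (1 - ‖z‖) := by
  have h0 := norm_nonneg z
  have hl : 1 - ‖z‖ ≤ ‖1 - conj (ξ : ℂ) * z‖ := by
    have := norm_sub_norm_le (1 : ℂ) (conj (ξ : ℂ) * z)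
    simpa using this
  have hu : ‖1 - conj (ξ : ℂ) * z‖ ≤ 1 + ‖z‖ := by
    have := norm_sub_le (1 : ℂ) (conj (ξ : ℂ) * z)
    simpa using this
  have hp : 0 < 1 - ‖z‖ := by linarith
  rw [diskPoissonKernel]
  constructor
  · rw [div_le_div_iff₀ (by positivity) (pow_pos (hp.trans_le hl) 2)]
    have : ‖1 - conj (ξ : ℂ) * z‖ ^ 2 ≤ (1 + ‖z‖) ^ 2 := by gcongr
    calc _ ≤ (1 - ‖z‖) * (1 + ‖z‖) ^ 2 := by gcongr
      _ = _ := by ring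
  · rw [div_le_div_iff₀ (pow_pos (hp.trans_le hl) 2) hp]
    have : (1 - ‖z‖) ^ 2 ≤ ‖1 - conj (ξ : ℂ) * z‖ ^ 2 := by gcongr
    calc _ = (1 + ‖z‖) * (1 - ‖z‖) ^ 2 := by ring
      _ ≤ _ := by gcongr

theorem diskPoissonKernel_pos {z : ℂ} (hz : ‖z‖ < 1) (ξ : Circle) : 0 < diskPoissonKernel z ξ :=
  lt_of_lt_of_le (div_pos (by linarith) (by positivity)) (diskPoissonKernel_bounds hz ξ).1

end CircleIntegrals

/-! ### Herglotz transforms and moments -/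

section Herglotz

/-- The Herglotz transform of a measure on the circle. -/
def herglotz (ν : Measure Circle) (z : ℂ) : ℂ :=
  ∫ ξ : Circle, (1 + conj (ξ : ℂ) * z) / (1 - conj (ξ : ℂ) * z) ∂ν

/-- The `k`-th trigonometric moment of a measure on the circle. -/
def moment (ν : Measure Circle) (k : ℕ) : ℂ :=
  ∫ ξ : Circle, conj (ξ : ℂ) ^ k ∂ν

theorem integrable_of_continuous {E : Type*} [NormedAddCommGroup E] (ν : Measure Circle)
    [IsFiniteMeasure ν] {g : Circle → E} (hg : Continuous g) : Integrable g ν :=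
  hg.integrable_of_hasCompactSupport (HasCompactSupport.of_compactSpace _)

variable (ν : Measure Circle) [IsProbabilityMeasure ν]

theorem norm_moment_le (k : ℕ) : ‖moment ν k‖ ≤ 1 := by
  have := norm_integral_le_of_norm_le_const (μ := ν) (C := 1)
    (f := fun ξ : Circle => conj (ξ : ℂ) ^ k) (.of_forall fun ξ => by simp)
  simpa [moment] using this

theorem continuous_herglotzKernel {z : ℂ} (hz : ‖z‖ < 1) :
    Continuous fun ξ : Circle => (1 + conj (ξ : ℂ) * z) / (1 - conj (ξ : ℂ) * z) :=
  Continuous.div (by fun_prop) (by fun_prop) (one_sub_conj_mul_ne_zero hz)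

theorem herglotzKernel_eq {z : ℂ} (hz : ‖z‖ < 1) (ξ : Circle) :
    (1 + conj (ξ : ℂ) * z) / (1 - conj (ξ : ℂ) * z) = 2 * (1 - conj (ξ : ℂ) * z)⁻¹ - 1 := by
  have := one_sub_conj_mul_ne_zero hz ξ
  field_simp
  ring

/-- Geometric expansion of the kernel `2 (1 - ξ̄ z)⁻¹ - 1`. Adding one to the transform lets the
constant term follow the same formula as the other coefficients. -/
theorem hasSum_herglotz {z : ℂ} (hz : ‖z‖ < 1) :
    HasSum (fun k => 2 * moment ν k * z ^ k) (herglotz ν z + 1) := by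
  have hsum : Summable fun k : ℕ => ‖z‖ ^ k := summable_geometric_of_lt_one (norm_nonneg _) hz
  have h := hasSum_integral_of_summable_integral_norm (μ := ν)
    (F := fun (k : ℕ) (ξ : Circle) => (conj (ξ : ℂ) * z) ^ k)
    (fun k => integrable_of_continuous ν (by fun_prop)) (by simpa using hsum)
  have h2 : ∀ ξ : Circle, ∑' k : ℕ, (conj (ξ : ℂ) * z) ^ k = (1 - conj (ξ : ℂ) * z)⁻¹ := fun ξ =>
    tsum_geometric_of_norm_lt_one (by simpa using hz)
  have hcont : Continuous fun ξ : Circle => (1 - conj (ξ : ℂ) * z)⁻¹ :=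
    Continuous.inv₀ (by fun_prop) (one_sub_conj_mul_ne_zero hz)
  simp_rw [h2, mul_pow, integral_mul_const] at h
  have h3 : herglotz ν z + 1 = 2 * ∫ ξ : Circle, (1 - conj (ξ : ℂ) * z)⁻¹ ∂ν := by
    simp_rw [herglotz, herglotzKernel_eq hz]
    rw [integral_sub ((integrable_of_continuous ν hcont).const_mul 2) (integrable_const _),
      integral_const_mul]
    simp
  rw [h3]
  simpa [moment, mul_assoc] using h.mul_left 2

theorem herglotz_zero : herglotz ν 0 = 1 := by simp [herglotz]

theorem analyticOnNhd_herglotz : AnalyticOnNhd ℂ (herglotz ν) (Metric.ball 0 1) := by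
  refine DifferentiableOn.analyticOnNhd (fun z hz => ?_) Metric.isOpen_ball
  have hz1 : ‖z‖ < 1 := by simpa using hz
  obtain ⟨r, hzr, hr1⟩ := exists_between hz1
  have hr0 : 0 ≤ r := (norm_nonneg z).trans hzr.le
  have hd : DifferentiableOn ℂ (fun w => ∑' k, 2 * moment ν k * w ^ k) (Metric.ball 0 r) :=
    Complex.differentiableOn_tsum_of_summable_norm (u := fun k => 2 * r ^ k)
      ((summable_geometric_of_lt_one hr0 hr1).mul_left 2) (fun k => by fun_prop)
      Metric.isOpen_ball fun k w hw => by
        have hw' : ‖w‖ ≤ r := by simpa using (Metric.mem_ball.mp hw).le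
        have hm := norm_moment_le ν k
        rw [norm_mul, norm_mul, norm_pow, Complex.norm_ofNat]
        calc 2 * ‖moment ν k‖ * ‖w‖ ^ k ≤ 2 * 1 * r ^ k := by gcongr
          _ = _ := by ring
  have hmem : Metric.ball (0 : ℂ) r ∈ 𝓝 z := Metric.isOpen_ball.mem_nhds (by simpa using hzr)
  refine DifferentiableAt.differentiableWithinAt ?_
  refine ((hd.differentiableAt hmem).sub_const 1).congr_of_eventuallyEq ?_
  filter_upwards [hmem] with w hw
  have hw' : ‖w‖ < 1 := lt_trans (by simpa using hw) hr1
  rw [(hasSum_herglotz ν hw').tsum_eq]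
  ring

theorem re_herglotzKernel (z : ℂ) (ξ : Circle) :
    ((1 + conj (ξ : ℂ) * z) / (1 - conj (ξ : ℂ) * z)).re = diskPoissonKernel z ξ := by
  rw [Complex.div_re, diskPoissonKernel, ← Complex.normSq_eq_norm_sq, ← Complex.normSq_eq_norm_sq,
    ← add_div]
  congr 1
  have h : Complex.normSq (conj (ξ : ℂ) * z) = Complex.normSq z := by simp
  rw [← h]
  simp only [Complex.normSq_apply, Complex.add_re, Complex.sub_re, Complex.add_im, Complex.sub_im,
    Complex.one_re, Complex.one_im]
  ring

theorem re_herglotz {z : ℂ} (hz : ‖z‖ < 1) : (herglotz ν z).re = poissonOfMeasure ν z := by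
  have := integral_re (𝕜 := ℂ) (integrable_of_continuous ν (continuous_herglotzKernel hz))
  rw [herglotz, poissonOfMeasure]
  simp_rw [← re_herglotzKernel]
  exact this.symm

theorem poissonOfMeasure_pos {z : ℂ} (hz : ‖z‖ < 1) : 0 < poissonOfMeasure ν z := by
  have hp : 0 < (1 - ‖z‖) / (1 + ‖z‖) := div_pos (by linarith) (by positivity)
  refine hp.trans_le ?_
  have := integral_mono (μ := ν) (integrable_const ((1 - ‖z‖) / (1 + ‖z‖)))
    (integrable_of_continuous ν (continuous_diskPoissonKernel hz))
    fun ξ => (diskPoissonKernel_bounds hz ξ).1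
  simpa [poissonOfMeasure] using this

/-- If a power series with bounded coefficients is `z ^ N * g z` near the origin, then its
coefficients of index below `N` vanish and that of index `N` is `g 0`. -/
theorem coeff_of_hasSum_eq_pow_mul {N : ℕ} {d : ℕ → ℂ} {C : ℝ} (hd : ∀ k, ‖d k‖ ≤ C) {g : ℂ → ℂ}
    (hg : ContinuousAt g 0) (h : ∀ᶠ z in 𝓝[≠] 0, HasSum (fun k => d k * z ^ k) (z ^ N * g z)) :
    (∀ k < N, d k = 0) ∧ d N = g 0 := by
  have hcont : ∀ e : ℕ → ℂ, (∀ k, ‖e k‖ ≤ C) →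
      Tendsto (fun z : ℂ => ∑' k, e k * z ^ k) (𝓝[≠] 0) (𝓝 (e 0)) := by
    intro e he
    have hc : ContinuousOn (fun z : ℂ => ∑' k, e k * z ^ k) (Metric.ball 0 (1 / 2)) := by
      refine continuousOn_tsum (u := fun k => C * (1 / 2) ^ k) (fun k => by fun_prop)
        ((summable_geometric_of_lt_one (by norm_num) (by norm_num)).mul_left C) fun k z hz => ?_
      have hz' : ‖z‖ ≤ 1 / 2 := by simpa using (Metric.mem_ball.mp hz).le
      have := norm_nonneg (e k)
      rw [norm_mul, norm_pow]
      exact mul_le_mul (he k) (pow_le_pow_left₀ (norm_nonneg z) hz' k) (by positivity)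
        (this.trans (he k))
    have h0 := (hc.continuousAt (Metric.ball_mem_nhds 0 (by norm_num))).tendsto
    have hval : ∑' k, e k * (0 : ℂ) ^ k = e 0 := by
      rw [tsum_eq_single 0 fun k hk => by simp [hk]]; simp
    rw [hval] at h0
    exact h0.mono_left nhdsWithin_le_nhds
  induction N generalizing d with
  | zero =>
    refine ⟨by simp, ?_⟩
    refine tendsto_nhds_unique (hcont d hd) (Tendsto.congr' ?_
      (hg.tendsto.mono_left nhdsWithin_le_nhds))
    filter_upwards [h] with z hz
    rw [hz.tsum_eq]; simp
  | succ N ih =>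
    have hd0 : d 0 = 0 := by
      refine tendsto_nhds_unique (hcont d hd) ?_
      have : Tendsto (fun z : ℂ => z ^ (N + 1) * g z) (𝓝[≠] 0) (𝓝 (0 ^ (N + 1) * g 0)) :=
        (((continuous_pow (N + 1)).continuousAt.mul hg).tendsto).mono_left nhdsWithin_le_nhds
      rw [zero_pow (Nat.succ_ne_zero N), zero_mul] at this
      refine Tendsto.congr' ?_ this
      filter_upwards [h] with z hz
      rw [hz.tsum_eq]
    have := ih (d := fun k => d (k + 1)) (fun k => hd _) (by
      filter_upwards [h, self_mem_nhdsWithin] with z hz hz0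
      have hz0 : z ≠ 0 := hz0
      rw [← hasSum_nat_add_iff' 1] at hz
      have := hz.mul_left z⁻¹
      simp only [Finset.range_one, Finset.sum_singleton, hd0, zero_mul, sub_zero] at this
      have e1 : ∀ k, z⁻¹ * (d (k + 1) * z ^ (k + 1)) = d (k + 1) * z ^ k := fun k => by
        rw [pow_succ]; field_simp
      have e2 : z⁻¹ * (z ^ (N + 1) * g z) = z ^ N * g z := by
        rw [pow_succ]; field_simp
      simp_rw [e1] at this
      rwa [e2] at this)
    refine ⟨fun k hk => ?_, this.2⟩
    cases k with
    | zero => exact hd0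
    | succ k => exact this.1 k (by omega)

/-- Two probability measures whose Herglotz transforms agree to order `N` at the origin have equal
moments below `N`, and the difference of the `N`-th moments is read off from the leading term. -/
theorem moment_sub_of_herglotz_sub {ν ρ : Measure Circle} [IsProbabilityMeasure ν]
    [IsProbabilityMeasure ρ] {N : ℕ} {g : ℂ → ℂ} (hg : ContinuousAt g 0)
    (h : ∀ z : ℂ, ‖z‖ < 1 → herglotz ν z - herglotz ρ z = z ^ N * g z) :
    (∀ k < N, moment ν k = moment ρ k) ∧ 2 * (moment ν N - moment ρ N) = g 0 := by
  have := coeff_of_hasSum_eq_pow_mul (d := fun k => 2 * (moment ν k - moment ρ k)) (C := 4) (N := N)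
    (fun k => by
      have h1 := norm_moment_le ν k
      have h2 := norm_moment_le ρ k
      have h3 := norm_sub_le (moment ν k) (moment ρ k)
      rw [norm_mul, Complex.norm_ofNat]
      linarith) hg (by
      filter_upwards [nhdsWithin_le_nhds (Metric.ball_mem_nhds (0 : ℂ) one_pos)] with z hz
      have hz' : ‖z‖ < 1 := by simpa using hz
      rw [← h z hz']
      have := (hasSum_herglotz ν hz').sub (hasSum_herglotz ρ hz')
      have e1 : ∀ k, 2 * moment ν k * z ^ k - 2 * moment ρ k * z ^ k =
          2 * (moment ν k - moment ρ k) * z ^ k := fun k => by ring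
      simp_rw [e1] at this
      rwa [add_sub_add_right_eq_sub] at this)
  refine ⟨fun k hk => ?_, this.2⟩
  simpa [sub_eq_zero] using this.1 k hk

/-- Schwarz's formula for an analytic function in terms of the boundary values of its real part. -/
theorem integral_herglotzKernel_mul_re {G : ℂ → ℂ}
    (hG : AnalyticOnNhd ℂ G (Metric.closedBall 0 1)) {z : ℂ} (hz : ‖z‖ < 1) :
    ∫ ξ : Circle, (1 + conj (ξ : ℂ) * z) / (1 - conj (ξ : ℂ) * z) * ((G ξ).re : ℂ)
      ∂circleLebesgue = G z - (G 0).im * Complex.I := by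
  have hGc := continuous_coe_circle_comp hG.continuousOn
  have hK := continuous_herglotzKernel hz
  have h1 : ∫ ξ : Circle, (1 + conj (ξ : ℂ) * z) / (1 - conj (ξ : ℂ) * z) * G ξ ∂circleLebesgue =
      2 * G z - G 0 := by
    have hcont : Continuous fun ξ : Circle => (1 - conj (ξ : ℂ) * z)⁻¹ * G ξ :=
      (Continuous.inv₀ (by fun_prop) (one_sub_conj_mul_ne_zero hz)).mul hGc
    have : ∀ ξ : Circle, (1 + conj (ξ : ℂ) * z) / (1 - conj (ξ : ℂ) * z) * G ξ =
        2 * ((1 - conj (ξ : ℂ) * z)⁻¹ * G ξ) - G ξ := fun ξ => by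
      rw [herglotzKernel_eq hz]; ring
    simp_rw [this]
    rw [integral_sub ((integrable_of_continuous _ hcont).const_mul 2)
      (integrable_of_continuous _ hGc), integral_const_mul, integral_cauchyKernel_mul hG hz,
      integral_circleLebesgue_eq_apply_zero hG]
  -- The conjugate of this integrand is the boundary value of a function analytic in `ξ`, since
  -- conjugating the kernel turns `ξ̄ z` into `ξ z̄`; the mean value property applies to it.
  have h2 : ∫ ξ : Circle, (1 + conj (ξ : ℂ) * z) / (1 - conj (ξ : ℂ) * z) * conj (G ξ)
      ∂circleLebesgue = conj (G 0) := by
    have hne : ∀ w ∈ Metric.closedBall (0 : ℂ) 1, 1 - w * conj z ≠ 0 := by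
      intro w hw h
      have hw : ‖w‖ ≤ 1 := by simpa using hw
      have : ‖w * conj z‖ = 1 := by rw [← sub_eq_zero.mp h]; simp
      rw [norm_mul, RCLike.norm_conj] at this
      nlinarith [norm_nonneg w, norm_nonneg z]
    have hA : AnalyticOnNhd ℂ (fun w => (1 + w * conj z) / (1 - w * conj z) * G w)
        (Metric.closedBall 0 1) := fun w hw =>
      (AnalyticAt.div (f := fun w => 1 + w * conj z) (g := fun w => 1 - w * conj z) (by fun_prop)
        (by fun_prop) (hne w hw)).mul (hG w hw)
    have := congrArg conj (integral_circleLebesgue_eq_apply_zero hA)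
    rw [← integral_conj] at this
    simpa using this
  have hcr : ∀ ξ : Circle, (1 + conj (ξ : ℂ) * z) / (1 - conj (ξ : ℂ) * z) * ((G ξ).re : ℂ) =
      (1 / 2) * ((1 + conj (ξ : ℂ) * z) / (1 - conj (ξ : ℂ) * z) * G ξ +
        (1 + conj (ξ : ℂ) * z) / (1 - conj (ξ : ℂ) * z) * conj (G ξ)) := fun ξ => by
    rw [Complex.re_eq_add_conj]; ring
  simp_rw [hcr]
  have i1 : Integrable (fun ξ : Circle => (1 + conj (ξ : ℂ) * z) / (1 - conj (ξ : ℂ) * z) * G ξ)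
    circleLebesgue := integrable_of_continuous _ (hK.mul hGc)
  have i2 : Integrable (fun ξ : Circle => (1 + conj (ξ : ℂ) * z) / (1 - conj (ξ : ℂ) * z) *
    conj (G ξ)) circleLebesgue :=
    integrable_of_continuous _ (hK.mul (Complex.continuous_conj.comp hGc))
  rw [integral_const_mul, integral_add i1 i2, h1, h2]
  have : G 0 - conj (G 0) = 2 * ((G 0).im * Complex.I) := by
    rw [Complex.sub_conj]; push_cast; ring
  linear_combination (-1 / 2 : ℂ) * this

end Herglotz

/-! ### Szegő recurrence and Bernstein–Szegő measures -/

section OrthogonalPolynomials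

open Polynomial

/-- The pair formed by the monic polynomial `Φ_n` and the reversed polynomial `Φ_n^*` generated by
Szegő's recurrence with parameters `a`. -/
def szegoPair (a : ℕ → ℂ) : ℕ → ℂ[X] × ℂ[X]
  | 0 => (1, 1)
  | n + 1 => (X * (szegoPair a n).1 - C (conj (a n)) * (szegoPair a n).2,
      (szegoPair a n).2 - C (a n) * (X * (szegoPair a n).1))

/-- The monic polynomial of degree `n` in Szegő's recurrence. -/
def szegoPoly (a : ℕ → ℂ) (n : ℕ) : ℂ[X] := (szegoPair a n).1

/-- The reversed polynomial in Szegő's recurrence. -/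
def szegoRev (a : ℕ → ℂ) (n : ℕ) : ℂ[X] := (szegoPair a n).2

/-- The squared norm `∏_{k < n} (1 - |a_k|²)` of the `n`-th orthogonal polynomial. -/
def szegoProd (a : ℕ → ℂ) (n : ℕ) : ℝ := ∏ k ∈ Finset.range n, (1 - ‖a k‖ ^ 2)

variable (a : ℕ → ℂ) (n : ℕ)

@[simp] theorem szegoPoly_zero : szegoPoly a 0 = 1 := rfl

@[simp] theorem szegoRev_zero : szegoRev a 0 = 1 := rfl

theorem szegoPoly_succ :
    szegoPoly a (n + 1) = X * szegoPoly a n - C (conj (a n)) * szegoRev a n := rfl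

theorem szegoRev_succ :
    szegoRev a (n + 1) = szegoRev a n - C (a n) * (X * szegoPoly a n) := rfl

theorem eval_szegoPoly_succ (z : ℂ) : (szegoPoly a (n + 1)).eval z =
    z * (szegoPoly a n).eval z - conj (a n) * (szegoRev a n).eval z := by
  simp [szegoPoly_succ]

theorem eval_szegoRev_succ (z : ℂ) : (szegoRev a (n + 1)).eval z =
    (szegoRev a n).eval z - a n * (z * (szegoPoly a n).eval z) := by
  simp [szegoRev_succ]

theorem natDegree_szego_le : (szegoPoly a n).natDegree ≤ n ∧ (szegoRev a n).natDegree ≤ n := by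
  induction n with
  | zero => simp
  | succ n ih =>
    obtain ⟨h1, h2⟩ := ih
    have hX : (X * szegoPoly a n).natDegree ≤ n + 1 :=
      natDegree_mul_le.trans (by rw [natDegree_X]; omega)
    rw [szegoPoly_succ, szegoRev_succ]
    exact ⟨natDegree_sub_le_of_le hX ((natDegree_C_mul_le _ _).trans (by omega)) |>.trans (by simp),
      natDegree_sub_le_of_le (show _ ≤ n + 1 by omega) ((natDegree_C_mul_le _ _).trans hX) |>.trans
        (by simp)⟩

theorem coeff_szegoPoly_self : (szegoPoly a n).coeff n = 1 := by
  induction n with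
  | zero => simp
  | succ n ih =>
    have : (szegoRev a n).coeff (n + 1) = 0 :=
      coeff_eq_zero_of_natDegree_lt (Nat.lt_succ_of_le (natDegree_szego_le a n).2)
    simp [szegoPoly_succ, ih, this]

theorem coeff_szegoRev_zero : (szegoRev a n).coeff 0 = 1 := by
  induction n with
  | zero => simp
  | succ n ih => simp [szegoRev_succ, ih]

theorem eval_szegoRev_zero : (szegoRev a n).eval 0 = 1 := by
  rw [← coeff_zero_eq_eval_zero, coeff_szegoRev_zero]

/-- Each step of the recurrence multiplies the determinant by `z (1 - |a_n|²)`. Changing the sign of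
the parameters produces the polynomials of the second kind, a second solution of the same recurrence
up to sign. -/
theorem szego_wronskian (z : ℂ) :
    (szegoPoly a n).eval z * (szegoRev (-a) n).eval z +
      (szegoRev a n).eval z * (szegoPoly (-a) n).eval z = 2 * z ^ n * szegoProd a n := by
  induction n with
  | zero => simp [szegoProd]; norm_num
  | succ n ih =>
    have hs : (szegoProd a (n + 1) : ℂ) = szegoProd a n * (1 - a n * conj (a n)) := by
      rw [szegoProd, Finset.prod_range_succ, ← szegoProd, Complex.mul_conj, Complex.normSq_eq_norm_sq]
      push_cast; ring
    simp only [eval_szegoPoly_succ, eval_szegoRev_succ, hs, Pi.neg_apply, map_neg]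
    linear_combination z * (1 - a n * conj (a n)) * ih

/-- The recurrence exchanges its two components under reversal, so the two identities have to be
carried through the induction together. -/
theorem szego_reverse (ξ : Circle) :
    (szegoRev a n).eval (ξ : ℂ) = (ξ : ℂ) ^ n * conj ((szegoPoly a n).eval (ξ : ℂ)) ∧
      (szegoPoly a n).eval (ξ : ℂ) = (ξ : ℂ) ^ n * conj ((szegoRev a n).eval (ξ : ℂ)) := by
  have hξ := conj_coe_circle_mul_self ξ
  induction n with
  | zero => simp
  | succ n ih =>
    obtain ⟨h1, h2⟩ := ih
    simp only [eval_szegoPoly_succ, eval_szegoRev_succ, map_sub, map_mul, Complex.conj_conj]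
    constructor
    · linear_combination h1 - a n * ξ * h2 -
        (ξ : ℂ) ^ n * conj ((szegoPoly a n).eval (ξ : ℂ)) * hξ
    · linear_combination ξ * h2 - conj (a n) * h1 +
        (ξ : ℂ) ^ n * conj (a n) * conj ((szegoPoly a n).eval (ξ : ℂ)) * hξ

/-- The matrix of a Szegő or Möbius step is, up to the scalar `1 - |a|²`, an isometry of the
indefinite form `|v|² - |u|²`. This drives the bound `|Φ_n| ≤ |Φ_n^*|`, the contractivity of Möbius
maps and the product identity. -/
theorem norm_sq_sub_norm_sq (a u v : ℂ) :
    ‖v - a * u‖ ^ 2 - ‖u - conj a * v‖ ^ 2 = (1 - ‖a‖ ^ 2) * (‖v‖ ^ 2 - ‖u‖ ^ 2) := by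
  simp only [← Complex.normSq_eq_norm_sq, Complex.normSq_apply, Complex.sub_re, Complex.sub_im,
    Complex.mul_re, Complex.mul_im, Complex.conj_re, Complex.conj_im]
  ring

variable {a n}

theorem szegoProd_pos (ha : ∀ k < n, ‖a k‖ < 1) : 0 < szegoProd a n :=
  Finset.prod_pos fun k hk => by
    have := ha k (Finset.mem_range.mp hk)
    have h0 := norm_nonneg (a k)
    nlinarith

/-- The form `|Φ_n^*|² - |z Φ_n|²` stays nonnegative, hence so does `|Φ_{n+1}^*|² - |Φ_{n+1}|²`. The
absence of zeros and the inequality feed each other in the induction. -/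
theorem norm_szegoPoly_le {z : ℂ} (ha : ∀ k < n, ‖a k‖ < 1) (hz : ‖z‖ ≤ 1) :
    (szegoRev a n).eval z ≠ 0 ∧ ‖(szegoPoly a n).eval z‖ ≤ ‖(szegoRev a n).eval z‖ := by
  induction n with
  | zero => simp
  | succ n ih =>
    obtain ⟨h1, h2⟩ := ih fun k hk => ha k (by omega)
    have han := ha n (by omega)
    have hzP : ‖z * (szegoPoly a n).eval z‖ ≤ ‖(szegoRev a n).eval z‖ := by
      rw [norm_mul]
      exact (mul_le_of_le_one_left (norm_nonneg _) hz).trans h2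
    have hpos := norm_pos_iff.mpr h1
    rw [eval_szegoRev_succ, eval_szegoPoly_succ]
    constructor
    · intro h0
      have h3 : ‖(szegoRev a n).eval z‖ = ‖a n‖ * ‖z * (szegoPoly a n).eval z‖ := by
        rw [← norm_mul, sub_eq_zero.mp h0]
      nlinarith [norm_nonneg (a n), norm_nonneg (z * (szegoPoly a n).eval z)]
    · have h3 := norm_sq_sub_norm_sq (a n) (z * (szegoPoly a n).eval z) ((szegoRev a n).eval z)
      have h4 : 0 ≤ (1 - ‖a n‖ ^ 2) * (‖(szegoRev a n).eval z‖ ^ 2 -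
          ‖z * (szegoPoly a n).eval z‖ ^ 2) := by
        apply mul_nonneg
        · nlinarith [norm_nonneg (a n)]
        · have := pow_le_pow_left₀ (norm_nonneg _) hzP 2
          linarith
      exact le_of_sq_le_sq (by linarith) (norm_nonneg _)

theorem norm_mul_szegoPoly_lt {z w : ℂ} (ha : ∀ k < n, ‖a k‖ < 1) (hz : ‖z‖ ≤ 1) (hw : ‖w‖ < 1) :
    ‖w * (szegoPoly a n).eval z‖ < ‖(szegoRev a n).eval z‖ := by
  obtain ⟨h1, h2⟩ := norm_szegoPoly_le ha hz
  rw [norm_mul]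
  calc ‖w‖ * ‖(szegoPoly a n).eval z‖ ≤ ‖w‖ * ‖(szegoRev a n).eval z‖ := by gcongr
    _ < _ := mul_lt_of_lt_one_left (norm_pos_iff.mpr h1) hw

theorem analyticOnNhd_eval (p : ℂ[X]) (s : Set ℂ) : AnalyticOnNhd ℂ (fun z => p.eval z) s :=
  fun z _ => p.differentiable.analyticAt z

/-- The quotient `Ψ_n^* / Φ_n^*`. -/
def szegoQuotient (a : ℕ → ℂ) (n : ℕ) (z : ℂ) : ℂ :=
  (szegoRev (-a) n).eval z / (szegoRev a n).eval z

/-- The Bernstein–Szegő weight `∏ (1 - |a_k|²) / |Φ_n^*|²`. -/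
def bernsteinWeight (a : ℕ → ℂ) (n : ℕ) (ξ : Circle) : ℝ :=
  szegoProd a n / ‖(szegoRev a n).eval (ξ : ℂ)‖ ^ 2

/-- The Bernstein–Szegő measure with parameters `a_0, …, a_{n-1}`. -/
def bernsteinMeasure (a : ℕ → ℂ) (n : ℕ) : Measure Circle :=
  circleLebesgue.withDensity fun ξ => ENNReal.ofReal (bernsteinWeight a n ξ)

theorem analyticOnNhd_szegoQuotient (ha : ∀ k < n, ‖a k‖ < 1) :
    AnalyticOnNhd ℂ (szegoQuotient a n) (Metric.closedBall 0 1) := fun z hz =>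
  (analyticOnNhd_eval _ _ z hz).div (analyticOnNhd_eval _ _ z hz)
    (norm_szegoPoly_le ha (by simpa using hz)).1

/-- On the circle, reversal turns the Wronskian identity into `2 Re (Ψ_n^* · conj Φ_n^*) = 2 S_n`;
divide by `|Φ_n^*|²`. -/
theorem re_szegoQuotient (ha : ∀ k < n, ‖a k‖ < 1) (ξ : Circle) :
    (szegoQuotient a n ξ).re = bernsteinWeight a n ξ := by
  have h0 := (norm_szegoPoly_le ha (norm_coe_circle ξ).le).1
  have hw := szego_wronskian a n ξ
  have h1 := (szego_reverse a n ξ).2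
  have h2 := (szego_reverse (-a) n ξ).2
  set p := (szegoRev a n).eval (ξ : ℂ)
  set q := (szegoRev (-a) n).eval (ξ : ℂ)
  rw [h1, h2] at hw
  have hξ : (ξ : ℂ) ^ n ≠ 0 := pow_ne_zero _ (Circle.coe_ne_zero ξ)
  have hw' : q * conj p + p * conj q = 2 * szegoProd a n :=
    mul_left_cancel₀ hξ (by linear_combination hw)
  have hpc : p * conj p = ((‖p‖ ^ 2 : ℝ) : ℂ) := by
    rw [Complex.mul_conj, Complex.normSq_eq_norm_sq]
  have hc : conj p ≠ 0 := by simpa using h0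
  apply Complex.ofReal_injective
  rw [Complex.re_eq_add_conj, szegoQuotient, bernsteinWeight]
  push_cast at hpc ⊢
  rw [← hpc, map_div₀]
  change (q / p + conj q / conj p) / 2 = _ / (p * conj p)
  field_simp
  linear_combination hw'

theorem continuous_szegoRev (a : ℕ → ℂ) (n : ℕ) :
    Continuous fun ξ : Circle => (szegoRev a n).eval (ξ : ℂ) :=
  (szegoRev a n).continuous.comp continuous_coe_circle

theorem bernsteinWeight_pos (ha : ∀ k < n, ‖a k‖ < 1) (ξ : Circle) : 0 < bernsteinWeight a n ξ :=
  div_pos (szegoProd_pos ha)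
    (pow_pos (norm_pos_iff.mpr (norm_szegoPoly_le ha (norm_coe_circle ξ).le).1) 2)

theorem continuous_bernsteinWeight (ha : ∀ k < n, ‖a k‖ < 1) :
    Continuous (bernsteinWeight a n) :=
  continuous_const.div ((continuous_szegoRev a n).norm.pow 2) fun ξ =>
    (pow_pos (norm_pos_iff.mpr (norm_szegoPoly_le ha (norm_coe_circle ξ).le).1) 2).ne'

theorem integral_bernsteinMeasure {E : Type*} [NormedAddCommGroup E] [NormedSpace ℝ E]
    (ha : ∀ k < n, ‖a k‖ < 1) (g : Circle → E) :
    ∫ ξ, g ξ ∂bernsteinMeasure a n = ∫ ξ, bernsteinWeight a n ξ • g ξ ∂circleLebesgue := by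
  rw [bernsteinMeasure, integral_withDensity_eq_integral_toReal_smul
    (continuous_bernsteinWeight ha).measurable.ennreal_ofReal (by simp)]
  simp_rw [ENNReal.toReal_ofReal (bernsteinWeight_pos ha _).le]

theorem isProbabilityMeasure_bernsteinMeasure (ha : ∀ k < n, ‖a k‖ < 1) :
    IsProbabilityMeasure (bernsteinMeasure a n) := by
  refine ⟨?_⟩
  have h1 : ∫ ξ : Circle, bernsteinWeight a n ξ ∂circleLebesgue = 1 := by
    simp_rw [← re_szegoQuotient ha]
    rw [integral_re_circleLebesgue (analyticOnNhd_szegoQuotient ha)]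
    simp [szegoQuotient, eval_szegoRev_zero]
  rw [bernsteinMeasure, withDensity_apply _ MeasurableSet.univ, Measure.restrict_univ,
    ← ofReal_integral_eq_lintegral_ofReal
      (integrable_of_continuous _ (continuous_bernsteinWeight ha))
      (.of_forall fun ξ => (bernsteinWeight_pos ha ξ).le), h1, ENNReal.ofReal_one]

/-- Schwarz's formula recovers the quotient from its boundary real part; no imaginary constant
appears because the quotient equals one at the origin. -/
theorem herglotz_bernsteinMeasure (ha : ∀ k < n, ‖a k‖ < 1) {z : ℂ} (hz : ‖z‖ < 1) :
    herglotz (bernsteinMeasure a n) z = szegoQuotient a n z := by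
  rw [herglotz, integral_bernsteinMeasure ha]
  have := integral_herglotzKernel_mul_re (analyticOnNhd_szegoQuotient ha) hz
  simp_rw [re_szegoQuotient ha] at this
  simp_rw [Complex.real_smul, mul_comm ((bernsteinWeight a n _ : ℝ) : ℂ)]
  rw [this]
  simp [szegoQuotient, eval_szegoRev_zero]

/-- The logarithm of `Φ_n^*`, as a sum of principal logarithms. -/
def logSzegoRev (a : ℕ → ℂ) (n : ℕ) (z : ℂ) : ℂ :=
  ∑ k ∈ Finset.range n,
    Complex.log (1 - a k * (z * (szegoPoly a k).eval z) / (szegoRev a k).eval z)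

/-- Keeps each ratio `Φ_{k+1}^* / Φ_k^*` in the right half-plane on the closed disk, so that
principal logarithms are analytic there and `logSzegoRev` needs no choice of branch. -/
theorem norm_szego_ratio_lt {k : ℕ} (ha : ∀ j < k + 1, ‖a j‖ < 1) {z : ℂ} (hz : ‖z‖ ≤ 1) :
    ‖a k * (z * (szegoPoly a k).eval z) / (szegoRev a k).eval z‖ < 1 := by
  have ha' : ∀ j < k, ‖a j‖ < 1 := fun j hj => ha j (by omega)
  have hw : ‖a k * z‖ < 1 := by
    rw [norm_mul]
    exact (mul_le_of_le_one_right (norm_nonneg _) hz).trans_lt (ha k (by omega))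
  have h := norm_mul_szegoPoly_lt ha' hz hw
  rw [norm_div, div_lt_one (norm_pos_iff.mpr (norm_szegoPoly_le ha' hz).1), ← mul_assoc]
  exact h

theorem one_sub_mem_slitPlane {u : ℂ} (hu : ‖u‖ < 1) : 1 - u ∈ Complex.slitPlane := by
  left
  have := Complex.re_le_norm u
  simp
  linarith

theorem analyticOnNhd_logSzegoRev (ha : ∀ k < n, ‖a k‖ < 1) :
    AnalyticOnNhd ℂ (logSzegoRev a n) (Metric.closedBall 0 1) := by
  intro z hz
  have hz' : ‖z‖ ≤ 1 := by simpa using hz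
  refine Finset.analyticAt_fun_sum _ fun k hk => ?_
  have hk := Finset.mem_range.mp hk
  refine AnalyticAt.clog ?_ (one_sub_mem_slitPlane
    (norm_szego_ratio_lt (fun j hj => ha j (by omega)) hz'))
  exact analyticAt_const.sub ((analyticAt_const.mul (analyticAt_id.mul
    (analyticOnNhd_eval _ _ z hz))).div (analyticOnNhd_eval _ _ z hz)
    (norm_szegoPoly_le (fun j hj => ha j (by omega)) hz').1)

theorem exp_logSzegoRev (ha : ∀ k < n, ‖a k‖ < 1) {z : ℂ} (hz : ‖z‖ ≤ 1) :
    Complex.exp (logSzegoRev a n z) = (szegoRev a n).eval z := by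
  induction n with
  | zero => simp [logSzegoRev]
  | succ n ih =>
    have hne := Complex.slitPlane_ne_zero (one_sub_mem_slitPlane (norm_szego_ratio_lt ha hz))
    have h0 := (norm_szegoPoly_le (fun j hj => ha j (Nat.lt_succ_of_lt hj)) hz).1
    rw [logSzegoRev, Finset.sum_range_succ, ← logSzegoRev, Complex.exp_add, Complex.exp_log hne,
      ih fun j hj => ha j (Nat.lt_succ_of_lt hj), eval_szegoRev_succ]
    field_simp

theorem re_logSzegoRev (ha : ∀ k < n, ‖a k‖ < 1) {z : ℂ} (hz : ‖z‖ ≤ 1) :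
    (logSzegoRev a n z).re = Real.log ‖(szegoRev a n).eval z‖ := by
  rw [← exp_logSzegoRev ha hz, Complex.norm_exp, Real.log_exp]

theorem log_bernsteinWeight (ha : ∀ k < n, ‖a k‖ < 1) (ξ : Circle) :
    Real.log (bernsteinWeight a n ξ) =
      Real.log (szegoProd a n) - 2 * (logSzegoRev a n ξ).re := by
  have h0 := norm_pos_iff.mpr (norm_szegoPoly_le ha (norm_coe_circle ξ).le).1
  rw [re_logSzegoRev ha (norm_coe_circle ξ).le, bernsteinWeight,
    Real.log_div (szegoProd_pos ha).ne' (pow_pos h0 2).ne', Real.log_pow]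
  norm_num

theorem integral_diskPoissonKernel {z : ℂ} (hz : ‖z‖ < 1) :
    ∫ ξ, diskPoissonKernel z ξ ∂circleLebesgue = 1 := by
  have := integral_diskPoissonKernel_mul_re (G := fun _ => 1) analyticOnNhd_const hz
  simpa using this

/-- As `Φ_n^*` has no zeros in the closed disk, `log |Φ_n^*|` is the real part of an analytic
function and is reproduced by the Poisson kernel. -/
theorem poissonOfFun_log_bernsteinWeight (ha : ∀ k < n, ‖a k‖ < 1) {z : ℂ} (hz : ‖z‖ < 1) :
    poissonOfFun (fun ξ => Real.log (bernsteinWeight a n ξ)) z =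
      Real.log (szegoProd a n) - 2 * Real.log ‖(szegoRev a n).eval z‖ := by
  have hG := analyticOnNhd_logSzegoRev ha
  have hP := continuous_diskPoissonKernel hz
  have h1 : Continuous fun ξ : Circle => (logSzegoRev a n ξ).re :=
    Complex.continuous_re.comp (continuous_coe_circle_comp hG.continuousOn)
  have h2 : ∀ ξ : Circle, diskPoissonKernel z ξ * Real.log (bernsteinWeight a n ξ) =
      diskPoissonKernel z ξ * Real.log (szegoProd a n) -
        2 * (diskPoissonKernel z ξ * (logSzegoRev a n ξ).re) := fun ξ => by
    rw [log_bernsteinWeight ha]; ring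
  simp_rw [poissonOfFun, h2]
  have h3 : Continuous fun ξ : Circle => 2 * (diskPoissonKernel z ξ * (logSzegoRev a n ξ).re) :=
    continuous_const.mul (hP.mul h1)
  rw [integral_sub (integrable_of_continuous _ (by fun_prop)) (integrable_of_continuous _ h3), integral_mul_const,
    integral_const_mul, integral_diskPoissonKernel_mul_re hG hz, re_logSzegoRev ha hz.le,
    integral_diskPoissonKernel hz, one_mul]

end OrthogonalPolynomials

/-! ### Inner products of polynomials in terms of moments -/

section Sesquilinear

open Polynomial

theorem integral_pow_mul_conj_pow (ν : Measure Circle) (i j : ℕ) :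
    ∫ ξ : Circle, (ξ : ℂ) ^ i * conj (ξ : ℂ) ^ j ∂ν =
      if i ≤ j then moment ν (j - i) else conj (moment ν (i - j)) := by
  have key : ∀ ξ : Circle, ∀ i k : ℕ, (ξ : ℂ) ^ i * conj (ξ : ℂ) ^ (i + k) = conj (ξ : ℂ) ^ k := by
    intro ξ i k
    rw [pow_add, ← mul_assoc, ← mul_pow, mul_comm (ξ : ℂ), conj_coe_circle_mul_self, one_pow,
      one_mul]
  split_ifs with h
  · obtain ⟨k, rfl⟩ := Nat.exists_eq_add_of_le h
    simp_rw [key, moment, Nat.add_sub_cancel_left]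
  · obtain ⟨k, rfl⟩ := Nat.exists_eq_add_of_le (not_le.mp h).le
    rw [Nat.add_sub_cancel_left, moment, ← integral_conj]
    congr 1; ext ξ
    have := congrArg conj (key ξ j k)
    simp only [map_mul, map_pow, Complex.conj_conj] at this ⊢
    rw [← this]; ring

theorem integral_pow_mul_conj_pow_eq {ν ρ : Measure Circle} {N : ℕ} (h : ∀ k < N, moment ν k = moment ρ k) {i j : ℕ}
    (hi : i < j + N) (hj : j < i + N) :
    ∫ ξ : Circle, (ξ : ℂ) ^ i * conj (ξ : ℂ) ^ j ∂ν =
      ∫ ξ : Circle, (ξ : ℂ) ^ i * conj (ξ : ℂ) ^ j ∂ρ := by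
  rw [integral_pow_mul_conj_pow, integral_pow_mul_conj_pow, h (j - i) (by omega),
    h (i - j) (by omega)]

variable (ν ρ : Measure Circle) [IsProbabilityMeasure ν] [IsProbabilityMeasure ρ]

theorem integral_eval_mul_conj_eval {p q : ℂ[X]} {N M : ℕ} (hp : p.natDegree < N)
    (hq : q.natDegree < M) :
    ∫ ξ : Circle, p.eval (ξ : ℂ) * conj (q.eval (ξ : ℂ)) ∂ν =
      ∑ i ∈ Finset.range N, ∑ j ∈ Finset.range M, p.coeff i * conj (q.coeff j) *
        ∫ ξ : Circle, (ξ : ℂ) ^ i * conj (ξ : ℂ) ^ j ∂ν := by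
  have h : ∀ ξ : Circle, p.eval (ξ : ℂ) * conj (q.eval (ξ : ℂ)) = ∑ i ∈ Finset.range N,
      ∑ j ∈ Finset.range M, p.coeff i * conj (q.coeff j) * ((ξ : ℂ) ^ i * conj (ξ : ℂ) ^ j) := by
    intro ξ
    rw [eval_eq_sum_range' hp, eval_eq_sum_range' hq, map_sum, Finset.sum_mul_sum]
    refine Finset.sum_congr rfl fun i _ => Finset.sum_congr rfl fun j _ => ?_
    rw [map_mul, map_pow]; ring
  simp_rw [h]
  rw [integral_finsetSum _ fun i _ => integrable_of_continuous _ (by fun_prop)]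
  refine Finset.sum_congr rfl fun i _ => ?_
  rw [integral_finsetSum _ fun i _ => integrable_of_continuous _ (by fun_prop)]
  exact Finset.sum_congr rfl fun j _ => integral_const_mul _ _

theorem integral_eval_mul_conj_eval_eq {N : ℕ} (h : ∀ k < N, moment ν k = moment ρ k) {p q : ℂ[X]}
    (hp : p.natDegree < N) (hq : q.natDegree < N) :
    ∫ ξ : Circle, p.eval (ξ : ℂ) * conj (q.eval (ξ : ℂ)) ∂ν =
      ∫ ξ : Circle, p.eval (ξ : ℂ) * conj (q.eval (ξ : ℂ)) ∂ρ := by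
  rw [integral_eval_mul_conj_eval ν hp hq, integral_eval_mul_conj_eval ρ hp hq]
  refine Finset.sum_congr rfl fun i hi => Finset.sum_congr rfl fun j hj => ?_
  have := Finset.mem_range.mp hi
  have := Finset.mem_range.mp hj
  rw [integral_pow_mul_conj_pow_eq h (by omega) (by omega)]

/-- Among the monomial pairs that occur, only `(N, 0)` has an index difference reaching `N`; all the
others cancel. -/
theorem integral_eval_mul_conj_eval_sub {N : ℕ} (hN : N ≠ 0) (h : ∀ k < N, moment ν k = moment ρ k)
    {p q : ℂ[X]} (hp : p.natDegree < N + 1) (hq : q.natDegree < N) :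
    ∫ ξ : Circle, p.eval (ξ : ℂ) * conj (q.eval (ξ : ℂ)) ∂ν -
      ∫ ξ : Circle, p.eval (ξ : ℂ) * conj (q.eval (ξ : ℂ)) ∂ρ =
      p.coeff N * conj (q.coeff 0) * conj (moment ν N - moment ρ N) := by
  rw [integral_eval_mul_conj_eval ν hp hq, integral_eval_mul_conj_eval ρ hp hq,
    ← Finset.sum_sub_distrib]
  simp_rw [← Finset.sum_sub_distrib, ← mul_sub]
  rw [Finset.sum_eq_single N]
  · rw [Finset.sum_eq_single 0]
    · rw [integral_pow_mul_conj_pow, integral_pow_mul_conj_pow, if_neg (by omega),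
        if_neg (by omega), Nat.sub_zero, map_sub]
    · intro j hj hj0
      rw [integral_pow_mul_conj_pow_eq h (by omega)
        (by have := Finset.mem_range.mp hj; omega), sub_self, mul_zero]
    · intro h0; exact absurd (Finset.mem_range.mpr (Nat.pos_of_ne_zero hN)) h0
  · intro i hi hiN
    refine Finset.sum_eq_zero fun j hj => ?_
    have := Finset.mem_range.mp hi
    have := Finset.mem_range.mp hj
    rw [integral_pow_mul_conj_pow_eq h (by omega) (by omega), sub_self, mul_zero]
  · intro h0; exact absurd (Finset.mem_range.mpr (Nat.lt_succ_self N)) h0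

end Sesquilinear

/-! ### The Schur algorithm and existence of the Schur family -/

section SchurAlgorithm

/-- The first `n + 1` members of a family satisfy the Schur algorithm for `μ`. -/
structure IsSchurPrefix (μ : Measure Circle) (f : ℕ → ℂ → ℂ) (n : ℕ) : Prop where
  analytic : ∀ k ≤ n, AnalyticOnNhd ℂ (f k) (Metric.ball 0 1)
  relation : ∀ z : ℂ, ‖z‖ < 1 → (1 + z * f 0 z) / (1 - z * f 0 z) = herglotz μ z
  step : ∀ k < n, ∀ z : ℂ, ‖z‖ < 1 →
    z * f (k + 1) z = (f k z - f k 0) / (1 - conj (f k 0) * f k z)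

theorem IsSchurPrefix.mono {μ : Measure Circle} {f : ℕ → ℂ → ℂ} {m n : ℕ}
    (h : IsSchurPrefix μ f n) (hmn : m ≤ n) : IsSchurPrefix μ f m :=
  ⟨fun k hk => h.analytic k (hk.trans hmn), h.relation, fun k hk => h.step k (by omega)⟩

theorem IsSchurFamily.isSchurPrefix {μ : Measure Circle} {f : ℕ → ℂ → ℂ} (h : IsSchurFamily μ f)
    (n : ℕ) : IsSchurPrefix μ f n :=
  ⟨fun k _ => h.analytic k, fun z hz => h.zero.relation z (by simpa using hz),
    fun k _ z hz => h.step k z (by simpa using hz)⟩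

theorem re_cayley (u : ℂ) : ((1 + u) / (1 - u)).re = (1 - ‖u‖ ^ 2) / ‖1 - u‖ ^ 2 := by
  rw [Complex.div_re, ← Complex.normSq_eq_norm_sq, ← Complex.normSq_eq_norm_sq, ← add_div]
  congr 1
  simp only [Complex.normSq_apply, Complex.add_re, Complex.sub_re, Complex.add_im, Complex.sub_im,
    Complex.one_re, Complex.one_im]
  ring

theorem norm_lt_one_of_re_cayley_pos {u : ℂ} (h : 0 < ((1 + u) / (1 - u)).re) : ‖u‖ < 1 := by
  rw [re_cayley] at h
  by_contra! hu
  have : (1 - ‖u‖ ^ 2) / ‖1 - u‖ ^ 2 ≤ 0 :=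
    div_nonpos_of_nonpos_of_nonneg (by nlinarith) (by positivity)
  linarith

theorem one_sub_conj_mul_ne_zero_of_norm_lt {a u : ℂ} (ha : ‖a‖ < 1) (hu : ‖u‖ < 1) :
    1 - conj a * u ≠ 0 := by
  intro h
  have : ‖conj a * u‖ = 1 := by rw [← sub_eq_zero.mp h]; simp
  rw [norm_mul, RCLike.norm_conj] at this
  nlinarith [norm_nonneg a, norm_nonneg u]

theorem norm_mobius_lt_one {a u : ℂ} (ha : ‖a‖ < 1) (hu : ‖u‖ < 1) :
    ‖(u - a) / (1 - conj a * u)‖ < 1 := by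
  have hne := one_sub_conj_mul_ne_zero_of_norm_lt ha hu
  rw [norm_div, div_lt_one (norm_pos_iff.mpr hne)]
  have h := norm_sq_sub_norm_sq (conj a) u 1
  rw [Complex.conj_conj, mul_one, RCLike.norm_conj, norm_one] at h
  have : 0 < (1 - ‖a‖ ^ 2) * (1 ^ 2 - ‖u‖ ^ 2) := by
    apply mul_pos <;> nlinarith [norm_nonneg a, norm_nonneg u]
  exact lt_of_pow_lt_pow_left₀ 2 (norm_nonneg _) (by linarith)

/-- If `z * g z` is bounded by one in the unit disk, then so is `g`. -/
theorem norm_le_one_of_norm_mul_lt_one {g : ℂ → ℂ} (hg : AnalyticOnNhd ℂ g (Metric.ball 0 1))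
    (h : ∀ z : ℂ, ‖z‖ < 1 → ‖z * g z‖ < 1) {z : ℂ} (hz : ‖z‖ < 1) : ‖g z‖ ≤ 1 := by
  have hne : ∀ w : ℂ, ‖w‖ < 1 → w ≠ 0 → ‖g w‖ ≤ 1 := by
    intro w hw hw0
    have := Complex.norm_le_norm_of_mapsTo_ball (f := fun w => w * g w) (R := 1) (z := w)
      (differentiableOn_id.mul hg.differentiableOn)
      (fun v hv => by simpa using (h v (by simpa using hv)).le) (by simp) hw
    rw [norm_mul] at this
    exact le_of_mul_le_mul_left (by simpa using this) (norm_pos_iff.mpr hw0)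
  by_cases hz0 : z = 0
  · subst hz0
    have hc : Tendsto (fun w => ‖g w‖) (𝓝[≠] 0) (𝓝 ‖g 0‖) :=
      ((hg 0 (by simp)).continuousAt.norm.tendsto).mono_left nhdsWithin_le_nhds
    refine le_of_tendsto hc ?_
    filter_upwards [nhdsWithin_le_nhds (Metric.ball_mem_nhds (0 : ℂ) one_pos),
      self_mem_nhdsWithin] with w hw hw0
    exact hne w (by simpa using hw) hw0
  · exact hne z hz hz0

variable {μ : Measure Circle} {f : ℕ → ℂ → ℂ} {n : ℕ}

/-- The Schur parameters `f_n(0)`. -/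
def schurParam (f : ℕ → ℂ → ℂ) (n : ℕ) : ℂ := f n 0

/-- Inverting the Möbius steps expresses `f_0` through `f_n` by a fractional linear map whose
coefficients are Szegő polynomials. The scalar `c = ∏ (1 + conj a_k · z f_{k+1}(z))` is the
denominator accumulated on the way; recording it turns a projective identity into exact ones, and
the isometry property at each step gives the third. -/
theorem IsSchurPrefix.exists_multiplier (h : IsSchurPrefix μ f n)
    (hf : ∀ k < n, ∀ z : ℂ, ‖z‖ < 1 → ‖f k z‖ < 1) {z : ℂ} (hz : ‖z‖ < 1) :
    ∃ c : ℂ,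
      (1 - z * f 0 z) * c = (szegoRev (schurParam f) n).eval z -
        z * (szegoPoly (schurParam f) n).eval z * f n z ∧
      (1 + z * f 0 z) * c = (szegoRev (-schurParam f) n).eval z +
        z * (szegoPoly (-schurParam f) n).eval z * f n z ∧
      (∏ k ∈ Finset.range n, (1 - ‖z * f k z‖ ^ 2) / (1 - ‖f k z‖ ^ 2)) *
        (1 - ‖z * f n z‖ ^ 2) * szegoProd (schurParam f) n = (1 - ‖z * f 0 z‖ ^ 2) * ‖c‖ ^ 2 := by
  induction n with
  | zero => exact ⟨1, by simp [szegoProd]⟩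
  | succ n ih =>
    obtain ⟨c, h1, h2, h3⟩ := ih (h.mono n.le_succ) fun k hk => hf k (by omega)
    set a := schurParam f n with ha
    have ha1 : ‖a‖ < 1 := hf n (by omega) 0 (by simp)
    have hfn : ‖f n z‖ < 1 := hf n (by omega) z hz
    have hne := one_sub_conj_mul_ne_zero_of_norm_lt ha1 hfn
    have hstep : z * f (n + 1) z * (1 - conj a * f n z) = f n z - a := by
      rw [h.step n (by omega) z hz]
      exact div_mul_cancel₀ _ hne
    set g := z * f (n + 1) z with hg
    -- The Möbius step solved for `f_n`, with the denominator cleared.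
    have hinv : f n z * (1 + conj a * g) = a + g := by linear_combination -hstep
    refine ⟨c * (1 + conj a * g), ?_, ?_, ?_⟩
    · rw [eval_szegoRev_succ, eval_szegoPoly_succ, ← ha, mul_right_comm, ← hg]
      linear_combination (1 + conj a * g) * h1 - z * (szegoPoly (schurParam f) n).eval z * hinv
    · rw [eval_szegoRev_succ, eval_szegoPoly_succ, Pi.neg_apply, ← ha, mul_right_comm, ← hg,
        map_neg]
      linear_combination (1 + conj a * g) * h2 + z * (szegoPoly (-schurParam f) n).eval z * hinv
    · have hnorm := norm_sq_sub_norm_sq (-conj a) g 1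
      have e1 : 1 - -conj a * g = 1 + conj a * g := by ring
      have e2 : g - conj (-conj a) * 1 = f n z * (1 + conj a * g) := by
        rw [hinv, map_neg, Complex.conj_conj]; ring
      rw [e1, e2, norm_mul, norm_neg, RCLike.norm_conj, norm_one] at hnorm
      have hpos : 1 - ‖f n z‖ ^ 2 ≠ 0 := by nlinarith [norm_nonneg (f n z)]
      rw [Finset.prod_range_succ, szegoProd, Finset.prod_range_succ, ← szegoProd, norm_mul c, ← ha]
      set P := ∏ k ∈ Finset.range n, (1 - ‖z * f k z‖ ^ 2) / (1 - ‖f k z‖ ^ 2)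
      field_simp
      linear_combination -P * (1 - ‖z * f n z‖ ^ 2) * szegoProd (schurParam f) n * hnorm +
        ‖1 + conj a * g‖ ^ 2 * (1 - ‖f n z‖ ^ 2) * h3

theorem schur_denominator_ne_zero (ha : ∀ k < n, ‖schurParam f k‖ < 1) {z : ℂ} (hz : ‖z‖ < 1)
    (hfz : ‖f n z‖ ≤ 1) :
    (szegoRev (schurParam f) n).eval z - z * (szegoPoly (schurParam f) n).eval z * f n z ≠ 0 := by
  intro h0
  have h1 : ‖z * f n z‖ < 1 := by
    rw [norm_mul]; exact (mul_le_of_le_one_right (norm_nonneg _) hfz).trans_lt hz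
  have h2 := norm_mul_szegoPoly_lt ha hz.le h1
  rw [sub_eq_zero.mp h0, mul_right_comm] at h2
  exact lt_irrefl _ h2

theorem IsSchurPrefix.norm_schurParam_lt (hf : ∀ k < n, ∀ z : ℂ, ‖z‖ < 1 → ‖f k z‖ < 1) :
    ∀ k < n, ‖schurParam f k‖ < 1 := fun k hk => hf k hk 0 (by simp)

/-- The two transforms are the images of `f_n` and of `0` under one fractional linear map, so their
difference is its determinant, a Wronskian of order `z ^ n`, times `z f_n`. Hence the exponent `n +
1`. -/
theorem IsSchurPrefix.herglotz_sub (h : IsSchurPrefix μ f n)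
    (hf : ∀ k < n, ∀ z : ℂ, ‖z‖ < 1 → ‖f k z‖ < 1) (hfn : ∀ z : ℂ, ‖z‖ < 1 → ‖f n z‖ ≤ 1)
    {z : ℂ} (hz : ‖z‖ < 1) :
    herglotz μ z - szegoQuotient (schurParam f) n z = z ^ (n + 1) *
      (2 * szegoProd (schurParam f) n * f n z /
        (((szegoRev (schurParam f) n).eval z -
          z * (szegoPoly (schurParam f) n).eval z * f n z) * (szegoRev (schurParam f) n).eval z)) := by
  have ha := IsSchurPrefix.norm_schurParam_lt hf
  obtain ⟨c, h1, h2, -⟩ := h.exists_multiplier hf hz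
  have hd := schur_denominator_ne_zero ha hz (hfn z hz)
  have hr := (norm_szegoPoly_le ha hz.le).1
  have hc : c ≠ 0 := by
    rintro rfl
    exact hd (by rw [← h1, mul_zero])
  have hw := szego_wronskian (schurParam f) n z
  rw [← h.relation z hz, szegoQuotient, ← mul_div_mul_right _ _ hc, h1, h2]
  rw [div_sub_div _ _ hd hr, mul_div_assoc', div_left_inj' (mul_ne_zero hd hr)]
  linear_combination z * f n z * hw

theorem IsSchurPrefix.moment_eq [IsProbabilityMeasure μ] (h : IsSchurPrefix μ f n)
    (hf : ∀ k < n, ∀ z : ℂ, ‖z‖ < 1 → ‖f k z‖ < 1) (hfn : ∀ z : ℂ, ‖z‖ < 1 → ‖f n z‖ ≤ 1) :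
    (∀ k < n + 1, moment μ k = moment (bernsteinMeasure (schurParam f) n) k) ∧
      moment μ (n + 1) - moment (bernsteinMeasure (schurParam f) n) (n + 1) =
        szegoProd (schurParam f) n * schurParam f n := by
  have ha := IsSchurPrefix.norm_schurParam_lt hf
  have := isProbabilityMeasure_bernsteinMeasure ha
  have hcf : ContinuousAt (f n) 0 := (h.analytic n le_rfl 0 (by simp)).continuousAt
  have hz0 : ‖(0 : ℂ)‖ < 1 := by simp
  have hm := moment_sub_of_herglotz_sub (ν := μ) (ρ := bernsteinMeasure (schurParam f) n)
    (N := n + 1)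
    (g := fun z => 2 * szegoProd (schurParam f) n * f n z /
        (((szegoRev (schurParam f) n).eval z -
          z * (szegoPoly (schurParam f) n).eval z * f n z) * (szegoRev (schurParam f) n).eval z))
    (by
      refine ContinuousAt.div (continuousAt_const.mul hcf) ?_ (mul_ne_zero
        (schur_denominator_ne_zero ha hz0 (hfn 0 hz0)) (norm_szegoPoly_le ha hz0.le).1)
      have c1 := (szegoRev (schurParam f) n).continuous.continuousAt (x := 0)
      have c2 := (szegoPoly (schurParam f) n).continuous.continuousAt (x := 0)
      exact (c1.sub ((continuousAt_id.mul c2).mul hcf)).mul c1)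
    (fun z hz => by rw [herglotz_bernsteinMeasure ha hz, h.herglotz_sub hf hfn hz])
  refine ⟨hm.1, ?_⟩
  have h2 := hm.2
  simp only [eval_szegoRev_zero, zero_mul, sub_zero, mul_one, div_one] at h2
  exact mul_left_cancel₀ two_ne_zero (by rw [h2, schurParam]; ring)

/-- Against the weight, `conj Φ_n^*` becomes `S_n / Φ_n^*`, leaving the analytic function `p /
Φ_n^*` and its mean value. -/
theorem integral_bernsteinMeasure_mul_conj {a : ℕ → ℂ} (ha : ∀ k < n, ‖a k‖ < 1) (p : Polynomial ℂ) :
    ∫ ξ : Circle, p.eval (ξ : ℂ) * conj ((szegoRev a n).eval (ξ : ℂ)) ∂bernsteinMeasure a n =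
      szegoProd a n * p.eval 0 := by
  have h1 : ∀ ξ : Circle, bernsteinWeight a n ξ •
      (p.eval (ξ : ℂ) * conj ((szegoRev a n).eval (ξ : ℂ))) =
        szegoProd a n * (p.eval (ξ : ℂ) / (szegoRev a n).eval (ξ : ℂ)) := by
    intro ξ
    have h0 := (norm_szegoPoly_le ha (norm_coe_circle ξ).le).1
    have hc : conj ((szegoRev a n).eval (ξ : ℂ)) ≠ 0 := by simpa using h0
    rw [Complex.real_smul, bernsteinWeight, ← Complex.normSq_eq_norm_sq]
    push_cast
    rw [← Complex.mul_conj]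
    field_simp
  have hA : AnalyticOnNhd ℂ (fun z => p.eval z / (szegoRev a n).eval z) (Metric.closedBall 0 1) :=
    fun z hz => (analyticOnNhd_eval _ _ z hz).div (analyticOnNhd_eval _ _ z hz)
      (norm_szegoPoly_le ha (by simpa using hz)).1
  rw [integral_bernsteinMeasure ha]
  simp_rw [h1]
  rw [integral_const_mul, integral_circleLebesgue_eq_apply_zero hA, eval_szegoRev_zero, div_one]

theorem IsSchurPrefix.integral_norm_szegoRev [IsProbabilityMeasure μ] (h : IsSchurPrefix μ f n)
    (hf : ∀ k < n, ∀ z : ℂ, ‖z‖ < 1 → ‖f k z‖ < 1) (hfn : ∀ z : ℂ, ‖z‖ < 1 → ‖f n z‖ ≤ 1) :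
    ∫ ξ : Circle, ‖(szegoRev (schurParam f) n).eval (ξ : ℂ)‖ ^ 2 ∂μ =
      szegoProd (schurParam f) n := by
  have ha := IsSchurPrefix.norm_schurParam_lt hf
  have := isProbabilityMeasure_bernsteinMeasure ha
  have hd := Nat.lt_succ_of_le (natDegree_szego_le (schurParam f) n).2
  have h1 := integral_eval_mul_conj_eval_eq μ (bernsteinMeasure (schurParam f) n)
    (h.moment_eq hf hfn).1 hd hd
  rw [integral_bernsteinMeasure_mul_conj ha, eval_szegoRev_zero, mul_one] at h1
  simp_rw [Complex.mul_conj, Complex.normSq_eq_norm_sq] at h1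
  rw [integral_complex_ofReal] at h1
  exact_mod_cast h1

/-- Only `|f_n| ≤ 1` is assumed, so `|a_n| = 1` is still possible and the Bernstein–Szegő measure of
level `n + 1` is unavailable. Instead `|Φ_n^* - a_n ξ Φ_n|²` is expanded, and the cross term is
computed from level `n` and the discrepancy of the moment of order `n + 1`. -/
theorem IsSchurPrefix.integral_norm_szegoRev_succ [IsProbabilityMeasure μ]
    (h : IsSchurPrefix μ f n)
    (hf : ∀ k < n, ∀ z : ℂ, ‖z‖ < 1 → ‖f k z‖ < 1) (hfn : ∀ z : ℂ, ‖z‖ < 1 → ‖f n z‖ ≤ 1) :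
    ∫ ξ : Circle, ‖(szegoRev (schurParam f) (n + 1)).eval (ξ : ℂ)‖ ^ 2 ∂μ =
      szegoProd (schurParam f) (n + 1) := by
  have ha := IsSchurPrefix.norm_schurParam_lt hf
  have := isProbabilityMeasure_bernsteinMeasure ha
  set a := schurParam f with ha_def
  have hdr := Nat.lt_succ_of_le (natDegree_szego_le a n).2
  have hdp : (Polynomial.X * szegoPoly a n).natDegree < n + 1 + 1 := by
    have := natDegree_szego_le a n
    have := Polynomial.natDegree_mul_le (p := (Polynomial.X : Polynomial ℂ)) (q := szegoPoly a n)
    rw [Polynomial.natDegree_X] at this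
    omega
  have hm := h.moment_eq hf hfn
  have h1 := integral_eval_mul_conj_eval_sub μ (bernsteinMeasure a n) (Nat.succ_ne_zero n) hm.1 hdp
    hdr
  rw [integral_bernsteinMeasure_mul_conj ha, hm.2, Polynomial.coeff_X_mul, coeff_szegoPoly_self,
    coeff_szegoRev_zero] at h1
  simp only [Polynomial.eval_mul, Polynomial.eval_X, zero_mul, mul_zero, sub_zero, map_one, one_mul,
    map_mul, Complex.conj_ofReal] at h1
  have h0 := h.integral_norm_szegoRev hf hfn
  have key : ∀ ξ : Circle, ‖(szegoRev a (n + 1)).eval (ξ : ℂ)‖ ^ 2 =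
      (1 + ‖a n‖ ^ 2) * ‖(szegoRev a n).eval (ξ : ℂ)‖ ^ 2 -
        2 * (a n * ((ξ : ℂ) * (szegoPoly a n).eval (ξ : ℂ) *
          conj ((szegoRev a n).eval (ξ : ℂ)))).re := by
    intro ξ
    -- On the circle `|Φ_n^*| = |ξ Φ_n|`, so the two square terms of the expansion merge.
    have hn : ‖(szegoRev a n).eval (ξ : ℂ)‖ = ‖(ξ : ℂ) * (szegoPoly a n).eval (ξ : ℂ)‖ := by
      rw [(szego_reverse a n ξ).1]; simp
    have e : (1 + ‖a n‖ ^ 2) * ‖(szegoRev a n).eval (ξ : ℂ)‖ ^ 2 =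
        ‖(szegoRev a n).eval (ξ : ℂ)‖ ^ 2 +
          ‖a n‖ ^ 2 * ‖(ξ : ℂ) * (szegoPoly a n).eval (ξ : ℂ)‖ ^ 2 := by
      rw [← hn]; ring
    rw [eval_szegoRev_succ, e]
    generalize (ξ : ℂ) * (szegoPoly a n).eval (ξ : ℂ) = u
    generalize (szegoRev a n).eval (ξ : ℂ) = v
    simp only [← Complex.normSq_eq_norm_sq, Complex.normSq_apply, Complex.sub_re, Complex.sub_im,
      Complex.mul_re, Complex.mul_im, Complex.conj_re, Complex.conj_im]
    ring
  have c1 := continuous_szegoRev a n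
  have c2 : Continuous fun ξ : Circle => (szegoPoly a n).eval (ξ : ℂ) :=
    (szegoPoly a n).continuous.comp continuous_coe_circle
  have c3 : Continuous fun ξ : Circle => a n * ((ξ : ℂ) * (szegoPoly a n).eval (ξ : ℂ) *
      conj ((szegoRev a n).eval (ξ : ℂ))) :=
    continuous_const.mul ((continuous_coe_circle.mul c2).mul (Complex.continuous_conj.comp c1))
  have hre : ∫ ξ : Circle, (a n * ((ξ : ℂ) * (szegoPoly a n).eval (ξ : ℂ) *
      conj ((szegoRev a n).eval (ξ : ℂ)))).re ∂μ = szegoProd a n * ‖a n‖ ^ 2 := by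
    have := integral_re (𝕜 := ℂ) (integrable_of_continuous μ c3)
    rw [integral_const_mul, h1] at this
    refine this.trans ?_
    have e : a n * (szegoProd a n * conj (a n)) = ((szegoProd a n * ‖a n‖ ^ 2 : ℝ) : ℂ) := by
      push_cast
      rw [mul_left_comm, Complex.mul_conj, Complex.normSq_eq_norm_sq]
      push_cast; rfl
    rw [e]; exact Complex.ofReal_re _
  simp_rw [key]
  have i1 : Integrable (fun ξ : Circle => (1 + ‖a n‖ ^ 2) * ‖(szegoRev a n).eval (ξ : ℂ)‖ ^ 2) μ :=
    integrable_of_continuous μ (continuous_const.mul (c1.norm.pow 2))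
  have i2 : Integrable (fun ξ : Circle => 2 * (a n * ((ξ : ℂ) * (szegoPoly a n).eval (ξ : ℂ) *
      conj ((szegoRev a n).eval (ξ : ℂ)))).re) μ :=
    integrable_of_continuous μ (continuous_const.mul (Complex.continuous_re.comp c3))
  rw [integral_sub i1 i2, integral_const_mul, integral_const_mul, h0, hre]
  rw [szegoProd, szegoProd, Finset.prod_range_succ]
  ring

theorem IsSzego.absolutelyContinuous (hμ : IsSzego μ) : circleLebesgue ≪ μ := by
  have := hμ.isProbabilityMeasure
  have h1 : circleLebesgue ≪ circleLebesgue.withDensity (μ.rnDeriv circleLebesgue) := by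
    refine withDensity_absolutelyContinuous' (μ.measurable_rnDeriv _).aemeasurable ?_
    filter_upwards [hμ.density_pos] with ξ hξ h0
    simp [density, h0] at hξ
  exact h1.trans (Measure.withDensity_rnDeriv_le μ circleLebesgue).absolutelyContinuous

/-- If `|a_n| = 1`, then `S_{n+1} = 0`, so `Φ_{n+1}^*` vanishes `μ`-almost everywhere. Positivity of
the density transfers this to Lebesgue measure, against the mean value `Φ_{n+1}^*(0) = 1`. -/
theorem IsSchurPrefix.norm_apply_zero_ne_one (hμ : IsSzego μ) (h : IsSchurPrefix μ f n)
    (hf : ∀ k < n, ∀ z : ℂ, ‖z‖ < 1 → ‖f k z‖ < 1) (hfn : ∀ z : ℂ, ‖z‖ < 1 → ‖f n z‖ ≤ 1) :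
    ‖f n 0‖ ≠ 1 := by
  intro h1
  have := hμ.isProbabilityMeasure
  have h2 := h.integral_norm_szegoRev_succ hf hfn
  have hc := continuous_szegoRev (schurParam f) (n + 1)
  have h3 : szegoProd (schurParam f) (n + 1) = 0 := by
    rw [szegoProd, Finset.prod_range_succ, schurParam, h1]; ring
  have hi : Integrable
      (fun ξ : Circle => ‖(szegoRev (schurParam f) (n + 1)).eval (ξ : ℂ)‖ ^ 2) μ :=
    integrable_of_continuous μ (hc.norm.pow 2)
  rw [h3, integral_eq_zero_iff_of_nonneg (fun ξ => by positivity) hi] at h2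
  have h4 := hμ.absolutelyContinuous.ae_le h2
  have h5 : ∫ ξ : Circle, (szegoRev (schurParam f) (n + 1)).eval (ξ : ℂ) ∂circleLebesgue = 0 := by
    rw [integral_eq_zero_of_ae]
    filter_upwards [h4] with ξ hξ
    simpa using hξ
  rw [integral_circleLebesgue_eq_apply_zero (analyticOnNhd_eval _ _), eval_szegoRev_zero] at h5
  exact one_ne_zero h5

theorem IsSchurPrefix.norm_mul_apply_zero_lt_one [IsProbabilityMeasure μ] (h : IsSchurPrefix μ f n)
    {z : ℂ} (hz : ‖z‖ < 1) : ‖z * f 0 z‖ < 1 := by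
  apply norm_lt_one_of_re_cayley_pos
  rw [h.relation z hz, re_herglotz μ hz]
  exact poissonOfMeasure_pos μ hz

/-- The Schwarz lemma gives `|f_k| ≤ 1`. Equality at one interior point would, by the maximum
principle, force `|f_k(0)| = 1`, which the Szegő condition excludes. -/
theorem IsSchurPrefix.norm_lt_one (hμ : IsSzego μ) (h : IsSchurPrefix μ f n) :
    ∀ k ≤ n, ∀ z : ℂ, ‖z‖ < 1 → ‖f k z‖ < 1 := by
  have := hμ.isProbabilityMeasure
  have hle : ∀ n, IsSchurPrefix μ f n → (∀ k < n, ∀ z : ℂ, ‖z‖ < 1 → ‖f k z‖ < 1) →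
      ∀ z : ℂ, ‖z‖ < 1 → ‖f n z‖ ≤ 1 := by
    intro n h hf z hz
    refine norm_le_one_of_norm_mul_lt_one (h.analytic n le_rfl) (fun z hz => ?_) hz
    cases n with
    | zero => exact h.norm_mul_apply_zero_lt_one hz
    | succ n =>
      rw [h.step n (by omega) z hz]
      exact norm_mobius_lt_one (hf n (by omega) 0 (by simp)) (hf n (by omega) z hz)
  intro k
  induction k using Nat.strong_induction_on with
  | _ k ih =>
    intro hk z hz
    have hf : ∀ j < k, ∀ z : ℂ, ‖z‖ < 1 → ‖f j z‖ < 1 := fun j hj => ih j hj (by omega)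
    have hp := h.mono hk
    have hkle := hle k hp hf
    refine lt_of_le_of_ne (hkle z hz) fun h1 => hp.norm_apply_zero_ne_one hμ hf hkle ?_
    have hmax : IsMaxOn (norm ∘ f k) (Metric.ball 0 1) z := fun w hw => by
      simpa [h1] using hkle w (by simpa using hw)
    have := Complex.norm_eqOn_of_isPreconnected_of_isMaxOn
      (convex_ball (0 : ℂ) 1).isPreconnected Metric.isOpen_ball (hp.analytic k le_rfl).differentiableOn
      (by simpa using hz) hmax (Metric.mem_ball_self one_pos)
    simpa [h1] using this

/-- The Schur family of a measure, with the removable singularities at the origin filled in. -/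
def schurFamily (μ : Measure Circle) : ℕ → ℂ → ℂ
  | 0 => dslope (fun z => (herglotz μ z - 1) / (herglotz μ z + 1)) 0
  | n + 1 => dslope (fun z => (schurFamily μ n z - schurFamily μ n 0) /
      (1 - conj (schurFamily μ n 0) * schurFamily μ n z)) 0

theorem mul_dslope_zero {g : ℂ → ℂ} (hg : g 0 = 0) (z : ℂ) : z * dslope g 0 z = g z := by
  have := sub_smul_dslope g 0 z
  simpa [hg] using this

theorem analyticOnNhd_dslope {g : ℂ → ℂ} (hg : AnalyticOnNhd ℂ g (Metric.ball 0 1)) :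
    AnalyticOnNhd ℂ (dslope g 0) (Metric.ball 0 1) :=
  ((Complex.differentiableOn_dslope (Metric.ball_mem_nhds (0 : ℂ) one_pos)).mpr
    hg.differentiableOn).analyticOnNhd Metric.isOpen_ball

theorem herglotz_add_one_ne_zero [IsProbabilityMeasure μ] {z : ℂ} (hz : ‖z‖ < 1) :
    herglotz μ z + 1 ≠ 0 := by
  intro h0
  have h1 := poissonOfMeasure_pos μ hz
  rw [← re_herglotz μ hz, eq_neg_of_add_eq_zero_left h0] at h1
  norm_num at h1

/-- Analyticity of `f_{n+1}` requires the denominator `1 - conj a_n · f_n` not to vanish, which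
follows from the strict bound on `f_n`. That bound therefore has to be available for finite
prefixes, before the whole family is known to exist. -/
theorem isSchurPrefix_schurFamily (hμ : IsSzego μ) (n : ℕ) :
    IsSchurPrefix μ (schurFamily μ) n := by
  have := hμ.isProbabilityMeasure
  induction n with
  | zero =>
    refine ⟨fun k hk => ?_, fun z hz => ?_, by simp⟩
    · obtain rfl := Nat.le_zero.mp hk
      refine analyticOnNhd_dslope fun z hz => ?_
      have hF := analyticOnNhd_herglotz μ z hz
      exact (hF.sub analyticAt_const).div (hF.add analyticAt_const)
        (herglotz_add_one_ne_zero (by simpa using hz))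
    · have hne := herglotz_add_one_ne_zero (μ := μ) hz
      rw [schurFamily, mul_dslope_zero (by simp [herglotz_zero])]
      have e1 : 1 - (herglotz μ z - 1) / (herglotz μ z + 1) = 2 / (herglotz μ z + 1) := by
        field_simp; ring
      rw [e1]
      field_simp
      ring
  | succ n ih =>
    have hlt := ih.norm_lt_one hμ n le_rfl
    have h0 := hlt 0 (by simp)
    refine ⟨fun k hk => ?_, ih.relation, fun k hk z hz => ?_⟩
    · rcases Nat.le_succ_iff.mp hk with hk | rfl
      · exact ih.analytic k hk
      · refine analyticOnNhd_dslope fun z hz => ?_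
        have hF := ih.analytic n le_rfl z hz
        exact (hF.sub analyticAt_const).div (analyticAt_const.sub (analyticAt_const.mul hF))
          (one_sub_conj_mul_ne_zero_of_norm_lt h0 (hlt z (by simpa using hz)))
    · rcases Nat.lt_succ_iff_lt_or_eq.mp hk with hk | rfl
      · exact ih.step k hk z hz
      · rw [schurFamily, mul_dslope_zero (by simp)]

theorem isSchurFamily_schurFamily (hμ : IsSzego μ) : IsSchurFamily μ (schurFamily μ) :=
  ⟨⟨(isSchurPrefix_schurFamily hμ 0).analytic 0 le_rfl, fun z hz =>
    (isSchurPrefix_schurFamily hμ 0).relation z (by simpa using hz)⟩,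
    fun n => (isSchurPrefix_schurFamily hμ n).analytic n le_rfl,
    fun n z hz => (isSchurPrefix_schurFamily hμ (n + 1)).step n n.lt_succ_self z (by simpa using hz)⟩

end SchurAlgorithm

/-! ### Uniform approximation by trigonometric polynomials -/

section TrigonometricApproximation

/-- Functions on the circle of the form `ξ̄ ^ N p(ξ)` are uniformly dense. -/
theorem exists_trigonometric_approx {g : Circle → ℝ} (hg : Continuous g) {ε : ℝ} (hε : 0 < ε) :
    ∃ (N : ℕ) (p : Polynomial ℂ), ∀ ξ : Circle,
      |(p.eval (ξ : ℂ) * conj (ξ : ℂ) ^ N).re - g ξ| < ε := by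
  let ι : C(Circle, ℂ) := ⟨fun ξ => (ξ : ℂ), continuous_coe_circle⟩
  let A : StarSubalgebra ℂ C(Circle, ℂ) := StarAlgebra.adjoin ℂ {ι}
  have hsep : A.SeparatesPoints := by
    intro x y hxy
    exact ⟨ι, ⟨ι, StarAlgebra.subset_adjoin ℂ _ (Set.mem_singleton ι), rfl⟩,
      fun h => hxy (Circle.ext h)⟩
  have hdense := ContinuousMap.starSubalgebra_topologicalClosure_eq_top_of_separatesPoints A hsep
  -- Clearing negative powers: on the circle every element of the star algebra generated by the
  -- coordinate is a polynomial times a power of `ξ̄`; sums are brought to a common power.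
  have hform : ∀ h ∈ A, ∃ (N : ℕ) (p : Polynomial ℂ), ∀ ξ : Circle,
      h ξ = p.eval (ξ : ℂ) * conj (ξ : ℂ) ^ N := by
    intro h hh
    have hh' : h ∈ Algebra.adjoin ℂ ({ι} ∪ star {ι} : Set C(Circle, ℂ)) := by
      rw [← StarAlgebra.adjoin_toSubalgebra]; exact hh
    induction hh' using Algebra.adjoin_induction with
    | mem x hx =>
      rcases hx with hx | hx
      · obtain rfl : x = ι := hx
        exact ⟨0, Polynomial.X, fun ξ => by simp [ι]⟩
      · rw [Set.star_singleton] at hx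
        obtain rfl : x = star ι := hx
        exact ⟨1, 1, fun ξ => by simp [ι]⟩
    | algebraMap r => exact ⟨0, Polynomial.C r, fun ξ => by simp⟩
    | add x y hx hy ihx ihy =>
      obtain ⟨N, p, h1⟩ := ihx (by rw [← StarAlgebra.adjoin_toSubalgebra] at hx; exact hx)
      obtain ⟨M, q, h2⟩ := ihy (by rw [← StarAlgebra.adjoin_toSubalgebra] at hy; exact hy)
      refine ⟨N + M, p * Polynomial.X ^ M + q * Polynomial.X ^ N, fun ξ => ?_⟩
      have key : ∀ k : ℕ, (ξ : ℂ) ^ k * conj (ξ : ℂ) ^ k = 1 := fun k => by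
        rw [← mul_pow, mul_comm, conj_coe_circle_mul_self, one_pow]
      simp only [ContinuousMap.add_apply, h1, h2, Polynomial.eval_add, Polynomial.eval_mul,
        Polynomial.eval_pow, Polynomial.eval_X, pow_add]
      linear_combination -p.eval (ξ : ℂ) * conj (ξ : ℂ) ^ N * key M -
        q.eval (ξ : ℂ) * conj (ξ : ℂ) ^ M * key N
    | mul x y hx hy ihx ihy =>
      obtain ⟨N, p, h1⟩ := ihx (by rw [← StarAlgebra.adjoin_toSubalgebra] at hx; exact hx)
      obtain ⟨M, q, h2⟩ := ihy (by rw [← StarAlgebra.adjoin_toSubalgebra] at hy; exact hy)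
      refine ⟨N + M, p * q, fun ξ => ?_⟩
      simp only [ContinuousMap.mul_apply, h1, h2, Polynomial.eval_mul, pow_add]
      ring
  let G : C(Circle, ℂ) := ⟨fun ξ => (g ξ : ℂ), Complex.continuous_ofReal.comp hg⟩
  have hG : G ∈ closure (A : Set C(Circle, ℂ)) := by
    rw [← StarSubalgebra.topologicalClosure_coe, hdense]; exact trivial
  obtain ⟨h, hhA, hh⟩ := Metric.mem_closure_iff.mp hG ε hε
  obtain ⟨N, p, hp⟩ := hform h hhA
  refine ⟨N, p, fun ξ => ?_⟩
  rw [← hp ξ]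
  have h1 : ‖h ξ - G ξ‖ < ε := by
    rw [← dist_eq_norm, dist_comm]
    exact (ContinuousMap.dist_apply_le_dist ξ).trans_lt hh
  refine lt_of_le_of_lt ?_ h1
  have := Complex.abs_re_le_norm (h ξ - G ξ)
  simpa [G] using this

end TrigonometricApproximation

/-! ### Test functions approximating the reciprocal of the density -/

section Variational

theorem log_sub_log_le {δ x y : ℝ} (hδ : 0 < δ) (hx : δ ≤ x) (hy : δ ≤ y) :
    Real.log x - Real.log y ≤ |x - y| / δ := by
  have hx0 := hδ.trans_le hx
  have hy0 := hδ.trans_le hy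
  rw [← Real.log_div hx0.ne' hy0.ne']
  have h1 := Real.log_le_sub_one_of_pos (div_pos hx0 hy0)
  have h2 : x / y - 1 = (x - y) / y := by field_simp
  have h3 : (x - y) / y ≤ |x - y| / δ := by
    calc (x - y) / y ≤ |x - y| / y := by gcongr; exact le_abs_self _
      _ ≤ |x - y| / δ := by gcongr
  linarith

variable {μ : Measure Circle}

theorem measurable_density (μ : Measure Circle) : Measurable (density μ) :=
  (μ.measurable_rnDeriv _).ennreal_toReal

theorem integrable_density (μ : Measure Circle) [IsFiniteMeasure μ] :
    Integrable (density μ) circleLebesgue :=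
  Measure.integrable_toReal_rnDeriv

theorem integral_withDensity_rnDeriv [IsFiniteMeasure μ] (g : Circle → ℝ) :
    ∫ ξ, g ξ ∂circleLebesgue.withDensity (μ.rnDeriv circleLebesgue) =
      ∫ ξ, density μ ξ * g ξ ∂circleLebesgue := by
  rw [integral_withDensity_eq_integral_toReal_smul (μ.measurable_rnDeriv _)
    (μ.rnDeriv_lt_top _)]
  rfl

theorem integral_density_mul_le [IsFiniteMeasure μ] {g : Circle → ℝ} (hg : Continuous g)
    (hg0 : ∀ ξ, 0 ≤ g ξ) : ∫ ξ, density μ ξ * g ξ ∂circleLebesgue ≤ ∫ ξ, g ξ ∂μ := by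
  rw [← integral_withDensity_rnDeriv]
  exact integral_mono_measure (Measure.withDensity_rnDeriv_le μ circleLebesgue)
    (.of_forall hg0) (integrable_of_continuous μ hg)

theorem integrable_density_mul [IsFiniteMeasure μ] {g : Circle → ℝ} (hg : Continuous g) :
    Integrable (fun ξ => density μ ξ * g ξ) circleLebesgue := by
  obtain ⟨C, hC⟩ := isCompact_univ.exists_bound_of_continuousOn hg.continuousOn
  exact (integrable_density μ).mul_bdd (c := C) hg.aestronglyMeasurable
    (.of_forall fun ξ => hC ξ (Set.mem_univ ξ))

/-- A bounded substitute for `1 / w`, bounded away from zero, whose `μ`-integral is nearly at most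
one and whose logarithm has nearly maximal integral. -/
theorem IsSzego.exists_bounded_test_function (hμ : IsSzego μ) {ε : ℝ} (hε : 0 < ε) :
    ∃ (δ M : ℝ) (h : Circle → ℝ), 0 < δ ∧ Measurable h ∧ (∀ ξ, δ ≤ h ξ) ∧ (∀ ξ, h ξ ≤ M) ∧
      ∫ ξ, h ξ ∂μ ≤ 1 + ε ∧
      -∫ ξ, Real.log (density μ ξ) ∂circleLebesgue - ε ≤ ∫ ξ, Real.log (h ξ) ∂circleLebesgue := by
  have := hμ.isProbabilityMeasure
  have hlog := hμ.integrable_log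
  -- Truncating `-log w` from above at `k` costs little by dominated convergence; the cap on the
  -- test function will be `M = exp k`.
  have hlim : Tendsto (fun k : ℕ => ∫ ξ, min (-Real.log (density μ ξ)) (k : ℝ) ∂circleLebesgue)
      atTop (𝓝 (∫ ξ, -Real.log (density μ ξ) ∂circleLebesgue)) := by
    refine tendsto_integral_of_dominated_convergence (fun ξ => ‖Real.log (density μ ξ)‖)
      (fun k => ?_) hlog.norm (fun k => .of_forall fun ξ => ?_) (.of_forall fun ξ => ?_)
    · exact ((Real.measurable_log.comp (measurable_density μ)).neg.min
        measurable_const).aestronglyMeasurable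
    · have hk : (0 : ℝ) ≤ k := k.cast_nonneg
      rw [Real.norm_eq_abs, Real.norm_eq_abs]
      rcases min_cases (-Real.log (density μ ξ)) (k : ℝ) with ⟨h1, h2⟩ | ⟨h1, h2⟩
      · rw [h1, abs_neg]
      · rw [h1, abs_of_nonneg hk, ← abs_neg]
        exact h2.le.trans (le_abs_self _)
    · obtain ⟨K, hK⟩ := exists_nat_ge (-Real.log (density μ ξ))
      refine tendsto_const_nhds.congr' ?_
      filter_upwards [eventually_ge_atTop K] with k hk
      rw [min_eq_left (hK.trans (by exact_mod_cast hk))]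
  rw [integral_neg] at hlim
  obtain ⟨k, hk⟩ := (hlim.eventually (lt_mem_nhds (sub_lt_self _ hε))).exists
  set δ := min (ε / 2) 1 with hδ_def
  have hδ : 0 < δ := by positivity
  have hδ1 : δ ≤ 1 := min_le_right _ _
  have hδε : δ ≤ ε / 2 := min_le_left _ _
  set M := Real.exp k with hM_def
  have hM : δ ≤ M := hδ1.trans (Real.one_le_exp k.cast_nonneg)
  have hsing := Measure.mutuallySingular_singularPart μ circleLebesgue
  set S := hsing.nullSet
  have hS : MeasurableSet S := hsing.measurableSet_nullSet
  classical
  let c : Circle → ℝ := fun ξ => max δ (min (density μ ξ)⁻¹ M)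
  have hcm : Measurable c := measurable_const.max ((measurable_density μ).inv.min measurable_const)
  -- `S` carries Lebesgue measure and is null for the singular part. There `h` is `1/w` clamped to
  -- `[δ, M]`; elsewhere it is `δ`, so the singular part contributes at most `δ` to the integral,
  -- while `w h ≤ 1 + δ w` almost everywhere.
  let h : Circle → ℝ := fun ξ => if ξ ∈ S then c ξ else δ
  have hm : Measurable h := Measurable.ite hS hcm measurable_const
  have hδh : ∀ ξ, δ ≤ h ξ := fun ξ => by
    by_cases hξ : ξ ∈ S <;> simp [h, c, hξ]
  have hhM : ∀ ξ, h ξ ≤ M := fun ξ => by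
    by_cases hξ : ξ ∈ S <;> simp [h, c, hξ, hM]
  have hint : ∀ ν : Measure Circle, IsFiniteMeasure ν → Integrable h ν := fun ν _ =>
    Integrable.of_bound hm.aestronglyMeasurable M (.of_forall fun ξ => by
      rw [Real.norm_of_nonneg (hδ.le.trans (hδh ξ))]; exact hhM ξ)
  have hae : ∀ᵐ ξ ∂circleLebesgue, h ξ = c ξ := by
    have h0 : circleLebesgue Sᶜ = 0 := hsing.measure_compl_nullSet
    filter_upwards [compl_mem_ae_iff.mpr h0] with ξ hξ
    have hξ : ξ ∈ S := by simpa using hξ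
    simp [h, hξ]
  have hae' : ∀ᵐ ξ ∂μ.singularPart circleLebesgue, h ξ = δ := by
    have h0 : μ.singularPart circleLebesgue S = 0 := hsing.measure_nullSet
    filter_upwards [compl_mem_ae_iff.mpr h0] with ξ hξ
    have hξ : ξ ∉ S := hξ
    simp [h, hξ]
  refine ⟨δ, M, h, hδ, hm, hδh, hhM, ?_, ?_⟩
  · have hdec := Measure.haveLebesgueDecomposition_add μ circleLebesgue
    have hle1 : μ.singularPart circleLebesgue ≤ μ := Measure.singularPart_le μ _
    have hle2 : circleLebesgue.withDensity (μ.rnDeriv circleLebesgue) ≤ μ :=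
      Measure.withDensity_rnDeriv_le μ _
    have e1 : ∫ ξ, h ξ ∂μ.singularPart circleLebesgue ≤ δ := by
      rw [integral_congr_ae hae', integral_const, smul_eq_mul]
      refine mul_le_of_le_one_left hδ.le ?_
      have : (μ.singularPart circleLebesgue).real Set.univ ≤ μ.real Set.univ :=
        ENNReal.toReal_mono (measure_ne_top μ _) (hle1 Set.univ)
      simpa using this
    have e2 : ∫ ξ, density μ ξ * h ξ ∂circleLebesgue ≤ 1 + δ := by
      have hb : ∫ ξ, density μ ξ * h ξ ∂circleLebesgue ≤
          ∫ ξ, (1 + δ * density μ ξ) ∂circleLebesgue := by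
        refine integral_mono_ae ((integrable_density μ).mul_bdd (c := M) hm.aestronglyMeasurable
          (.of_forall fun ξ => ?_)) ((integrable_const 1).add ((integrable_density μ).const_mul δ)) ?_
        · rw [Real.norm_of_nonneg (hδ.le.trans (hδh ξ))]; exact hhM ξ
        · filter_upwards [hae, hμ.density_pos] with ξ hξ hpos
          rw [hξ]
          have h1 : c ξ ≤ δ + (density μ ξ)⁻¹ := by
            have hi : 0 ≤ (density μ ξ)⁻¹ := (inv_pos.mpr hpos).le
            exact max_le (by linarith) ((min_le_left _ _).trans (by linarith))
          calc density μ ξ * c ξ ≤ density μ ξ * (δ + (density μ ξ)⁻¹) := by gcongr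
            _ = 1 + δ * density μ ξ := by field_simp; ring
      have hd : ∫ ξ, density μ ξ ∂circleLebesgue ≤ 1 := by
        have := integral_density_mul_le (μ := μ) (g := fun _ => 1) continuous_const (by simp)
        simpa using this
      rw [integral_add (integrable_const _) ((integrable_density μ).const_mul δ),
        integral_const_mul] at hb
      simp only [integral_const, probReal_univ, smul_eq_mul, mul_one] at hb
      nlinarith
    rw [hdec, integral_add_measure ((hint μ inferInstance).mono_measure hle1)
      ((hint μ inferInstance).mono_measure hle2), integral_withDensity_rnDeriv]
    linarith
  · refine hk.le.trans ?_
    refine integral_mono_ae ?_ ?_ ?_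
    · refine hlog.norm.mono' ((Real.measurable_log.comp (measurable_density μ)).neg.min
        measurable_const).aestronglyMeasurable (.of_forall fun ξ => ?_)
      have hk : (0 : ℝ) ≤ k := k.cast_nonneg
      rw [Real.norm_eq_abs, Real.norm_eq_abs]
      rcases min_cases (-Real.log (density μ ξ)) (k : ℝ) with ⟨h1, h2⟩ | ⟨h1, h2⟩
      · rw [h1, abs_neg]
      · rw [h1, abs_of_nonneg hk, ← abs_neg]
        exact h2.le.trans (le_abs_self _)
    · refine Integrable.of_bound (Real.measurable_log.comp hm).aestronglyMeasurable
        (max |Real.log δ| |Real.log M|) (.of_forall fun ξ => ?_)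
      exact abs_le_max_abs_abs (Real.log_le_log hδ (hδh ξ))
        (Real.log_le_log (hδ.trans_le (hδh ξ)) (hhM ξ))
    · filter_upwards [hae, hμ.density_pos] with ξ hξ hpos
      have hmin : 0 < min (density μ ξ)⁻¹ M := lt_min (inv_pos.mpr hpos) (Real.exp_pos _)
      rw [hξ]
      refine le_trans ?_ (Real.log_le_log hmin (le_max_right _ _))
      rcases min_cases (density μ ξ)⁻¹ M with ⟨h1, -⟩ | ⟨h1, -⟩
      · rw [h1, Real.log_inv]; exact min_le_left _ _
      · rw [h1, hM_def, Real.log_exp]; exact min_le_right _ _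

theorem abs_clamp_sub_clamp_le (δ M x y : ℝ) :
    |max δ (min x M) - max δ (min y M)| ≤ |x - y| := by
  refine (abs_max_sub_max_le_max _ _ _ _).trans ?_
  rw [sub_self, abs_zero, max_eq_right (abs_nonneg _)]
  refine (abs_min_sub_min_le_max _ _ _ _).trans ?_
  rw [sub_self, abs_zero, max_eq_left (abs_nonneg _)]

/-- Approximating in `L¹(μ + m)` controls both integrals at once. Clamping the approximant to `[δ,
M]` does not increase the error and makes the logarithm Lipschitz with constant `1/δ`. -/
theorem IsSzego.exists_continuous_test_function (hμ : IsSzego μ) {ε : ℝ} (hε : 0 < ε) :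
    ∃ (δ : ℝ) (g : Circle → ℝ), 0 < δ ∧ Continuous g ∧ (∀ ξ, δ ≤ g ξ) ∧ ∫ ξ, g ξ ∂μ ≤ 1 + ε ∧
      -∫ ξ, Real.log (density μ ξ) ∂circleLebesgue - ε ≤ ∫ ξ, Real.log (g ξ) ∂circleLebesgue := by
  have := hμ.isProbabilityMeasure
  obtain ⟨δ, M, h, hδ, hm, hδh, hhM, h1, h2⟩ := hμ.exists_bounded_test_function (half_pos hε)
  have hint : ∀ ν : Measure Circle, IsFiniteMeasure ν → Integrable h ν := fun ν _ =>
    Integrable.of_bound hm.aestronglyMeasurable M (.of_forall fun ξ => by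
      rw [Real.norm_of_nonneg (hδ.le.trans (hδh ξ))]; exact hhM ξ)
  set η := min (ε / 2) (ε / 2 * δ) with hη_def
  have hη : 0 < η := by positivity
  obtain ⟨g₀, hg₀, -⟩ :=
    (hint (μ + circleLebesgue) inferInstance).exists_boundedContinuous_integral_sub_le hη
  let g : Circle → ℝ := fun ξ => max δ (min (g₀ ξ) M)
  have hg : Continuous g := continuous_const.max (g₀.continuous.min continuous_const)
  have hδg : ∀ ξ, δ ≤ g ξ := fun ξ => le_max_left _ _
  have hclose : ∀ ξ, |h ξ - g ξ| ≤ ‖h ξ - g₀ ξ‖ := fun ξ => by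
    have := abs_clamp_sub_clamp_le δ M (h ξ) (g₀ ξ)
    rwa [min_eq_left (hhM ξ), max_eq_right (hδh ξ)] at this
  have hi : ∀ ν : Measure Circle, IsFiniteMeasure ν → Integrable (fun ξ => ‖h ξ - g₀ ξ‖) ν :=
    fun ν hν => ((hint ν hν).sub (integrable_of_continuous ν g₀.continuous)).norm
  rw [integral_add_measure (hi μ inferInstance) (hi circleLebesgue inferInstance)] at hg₀
  have p1 : 0 ≤ ∫ ξ, ‖h ξ - g₀ ξ‖ ∂μ := integral_nonneg fun _ => norm_nonneg _
  have p2 : 0 ≤ ∫ ξ, ‖h ξ - g₀ ξ‖ ∂circleLebesgue := integral_nonneg fun _ => norm_nonneg _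
  have hη1 : η ≤ ε / 2 := min_le_left _ _
  have hη2 : η ≤ ε / 2 * δ := min_le_right _ _
  refine ⟨δ, g, hδ, hg, hδg, ?_, ?_⟩
  · have : ∫ ξ, g ξ ∂μ ≤ ∫ ξ, (h ξ + ‖h ξ - g₀ ξ‖) ∂μ :=
      integral_mono (integrable_of_continuous μ hg)
        ((hint μ inferInstance).add (hi μ inferInstance)) fun ξ => by
          have h3 := (abs_le.mp (hclose ξ)).1
          change g ξ ≤ h ξ + ‖h ξ - g₀ ξ‖
          linarith
    rw [integral_add (hint μ inferInstance) (hi μ inferInstance)] at this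
    linarith
  · have hlg : Integrable (fun ξ => Real.log (g ξ)) circleLebesgue :=
      integrable_of_continuous _ (hg.log fun ξ => (hδ.trans_le (hδg ξ)).ne')
    have hlh : Integrable (fun ξ => Real.log (h ξ)) circleLebesgue :=
      Integrable.of_bound (Real.measurable_log.comp hm).aestronglyMeasurable
        (max |Real.log δ| |Real.log M|) (.of_forall fun ξ =>
          abs_le_max_abs_abs (Real.log_le_log hδ (hδh ξ))
            (Real.log_le_log (hδ.trans_le (hδh ξ)) (hhM ξ)))
    have : ∫ ξ, Real.log (h ξ) ∂circleLebesgue ≤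
        ∫ ξ, (Real.log (g ξ) + ‖h ξ - g₀ ξ‖ / δ) ∂circleLebesgue :=
      integral_mono hlh (hlg.add ((hi circleLebesgue inferInstance).div_const δ)) fun ξ => by
        have h3 := log_sub_log_le hδ (hδh ξ) (hδg ξ)
        have h4 : |h ξ - g ξ| / δ ≤ ‖h ξ - g₀ ξ‖ / δ := by gcongr; exact hclose ξ
        change Real.log (h ξ) ≤ Real.log (g ξ) + ‖h ξ - g₀ ξ‖ / δ
        linarith
    rw [integral_add hlg ((hi circleLebesgue inferInstance).div_const δ), integral_div] at this
    have h5 : (∫ ξ, ‖h ξ - g₀ ξ‖ ∂circleLebesgue) / δ ≤ ε / 2 := by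
      rw [div_le_iff₀ hδ]; linarith
    linarith

theorem IsSzego.exists_trigonometric_test_function (hμ : IsSzego μ) {ε : ℝ} (hε : 0 < ε) :
    ∃ (N : ℕ) (p : Polynomial ℂ), (∀ ξ : Circle, 0 < (p.eval (ξ : ℂ) * conj (ξ : ℂ) ^ N).re) ∧
      ∫ ξ : Circle, (p.eval (ξ : ℂ) * conj (ξ : ℂ) ^ N).re ∂μ ≤ 1 + ε ∧
      -∫ ξ, Real.log (density μ ξ) ∂circleLebesgue - ε ≤
        ∫ ξ : Circle, Real.log (p.eval (ξ : ℂ) * conj (ξ : ℂ) ^ N).re ∂circleLebesgue := by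
  have := hμ.isProbabilityMeasure
  obtain ⟨δ, g, hδ, hg, hδg, h1, h2⟩ := hμ.exists_continuous_test_function (half_pos hε)
  -- The three bounds serve, in order, the `μ`-integral, positivity of the polynomial (it stays
  -- above `δ / 2`), and the logarithm, which has Lipschitz constant `2 / δ` there.
  set η := min (ε / 2) (min (δ / 2) (ε / 2 * (δ / 2))) with hη_def
  have hη : 0 < η := by positivity
  have hη1 : η ≤ ε / 2 := min_le_left _ _
  have hη2 : η ≤ δ / 2 := (min_le_right _ _).trans (min_le_left _ _)
  have hη3 : η ≤ ε / 2 * (δ / 2) := (min_le_right _ _).trans (min_le_right _ _)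
  obtain ⟨N, p, hp⟩ := exists_trigonometric_approx hg hη
  let T : Circle → ℝ := fun ξ => (p.eval (ξ : ℂ) * conj (ξ : ℂ) ^ N).re
  have hT : Continuous T := Complex.continuous_re.comp
    ((p.continuous.comp continuous_coe_circle).mul (by fun_prop))
  have hp' : ∀ ξ, |T ξ - g ξ| < η := hp
  have hTδ : ∀ ξ, δ / 2 ≤ T ξ := fun ξ => by
    have := (abs_lt.mp (hp' ξ)).1
    have := hδg ξ
    linarith
  refine ⟨N, p, fun ξ => (half_pos hδ).trans_le (hTδ ξ), ?_, ?_⟩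
  · change ∫ ξ, T ξ ∂μ ≤ 1 + ε
    have : ∫ ξ, T ξ ∂μ ≤ ∫ ξ, (g ξ + η) ∂μ :=
      integral_mono (integrable_of_continuous μ hT)
        (integrable_of_continuous μ (hg.add continuous_const)) fun ξ => by
          have h3 := (abs_lt.mp (hp' ξ)).2
          change T ξ ≤ g ξ + η
          linarith
    rw [integral_add (integrable_of_continuous μ hg) (integrable_const _)] at this
    simp only [integral_const, probReal_univ, smul_eq_mul, one_mul] at this
    linarith
  · change _ ≤ ∫ ξ, Real.log (T ξ) ∂circleLebesgue
    have hlT : Continuous fun ξ => Real.log (T ξ) :=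
      hT.log fun ξ => ((half_pos hδ).trans_le (hTδ ξ)).ne'
    have hlg : Continuous fun ξ => Real.log (g ξ) := hg.log fun ξ => (hδ.trans_le (hδg ξ)).ne'
    have : ∫ ξ, Real.log (g ξ) ∂circleLebesgue ≤
        ∫ ξ, (Real.log (T ξ) + ε / 2) ∂circleLebesgue :=
      integral_mono (integrable_of_continuous _ hlg)
        (integrable_of_continuous _ (hlT.add continuous_const)) fun ξ => by
          have h3 := log_sub_log_le (half_pos hδ) (by linarith [hδg ξ]) (hTδ ξ) (x := g ξ)
          have h4 : |g ξ - T ξ| / (δ / 2) ≤ ε / 2 := by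
            rw [div_le_iff₀ (half_pos hδ), abs_sub_comm]
            exact (hp' ξ).le.trans hη3
          change Real.log (g ξ) ≤ Real.log (T ξ) + ε / 2
          linarith
    rw [integral_add (integrable_of_continuous _ hlT) (integrable_const _)] at this
    simp only [integral_const, probReal_univ, smul_eq_mul, one_mul] at this
    linarith

end Variational

/-! ### From integrals of exponentials to Poisson integrals -/

section Convergence

/-- The tangent line of `exp` at `t` gives `exp x - 1 - x ≥ (exp t - 1)(x - t)`. The companion bound
for `-x` uses the tangent at `-t`. -/
theorem le_add_of_exp_tangent {t x : ℝ} (ht : 0 < t) :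
    x ≤ t + (Real.exp x - 1 - x) / (Real.exp t - 1) := by
  have h1 : Real.exp t * (x - t + 1) ≤ Real.exp x := by
    have := mul_le_mul_of_nonneg_left (Real.add_one_le_exp (x - t)) (Real.exp_pos t).le
    rwa [← Real.exp_add, add_sub_cancel] at this
  have h2 : t < Real.exp t - 1 := by linarith [Real.add_one_lt_exp ht.ne']
  rw [← sub_le_iff_le_add', le_div_iff₀ (by linarith)]
  nlinarith

theorem neg_le_add_of_exp_tangent {t x : ℝ} (ht : 0 < t) :
    -x ≤ t + (Real.exp x - 1 - x) / (1 - Real.exp (-t)) := by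
  have h1 : Real.exp (-t) * (x + t + 1) ≤ Real.exp x := by
    have := mul_le_mul_of_nonneg_left (Real.add_one_le_exp (x + t)) (Real.exp_pos (-t)).le
    rwa [← Real.exp_add, neg_add_eq_sub, add_sub_cancel_right] at this
  have h2 : 1 - Real.exp (-t) < t := by linarith [Real.add_one_lt_exp (neg_ne_zero.mpr ht.ne')]
  have h3 : 0 < 1 - Real.exp (-t) := by
    have : Real.exp (-t) < 1 := by simpa using ht
    linarith
  rw [← sub_le_iff_le_add', le_div_iff₀ h3]
  nlinarith

theorem integral_diskPoissonKernel_mul_le {z : ℂ} (hz : ‖z‖ < 1) {x y : Circle → ℝ} {t K : ℝ}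
    (hx : Integrable x circleLebesgue) (hy : Integrable y circleLebesgue) (hy0 : ∀ ξ, 0 ≤ y ξ)
    (hK : 0 ≤ K) (h : ∀ ξ, x ξ ≤ t + y ξ * K) :
    ∫ ξ, diskPoissonKernel z ξ * x ξ ∂circleLebesgue ≤
      t + (1 + ‖z‖) / (1 - ‖z‖) * K * ∫ ξ, y ξ ∂circleLebesgue := by
  have hP := continuous_diskPoissonKernel hz
  have hPi : Integrable (fun ξ => diskPoissonKernel z ξ * t) circleLebesgue :=
    integrable_of_continuous _ (hP.mul continuous_const)
  have h1 : ∫ ξ, diskPoissonKernel z ξ * x ξ ∂circleLebesgue ≤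
      ∫ ξ, (diskPoissonKernel z ξ * t + (1 + ‖z‖) / (1 - ‖z‖) * K * y ξ) ∂circleLebesgue := by
    refine integral_mono (hx.bdd_mul (c := (1 + ‖z‖) / (1 - ‖z‖)) hP.aestronglyMeasurable
      (.of_forall fun ξ => ?_)) (hPi.add (hy.const_mul _)) fun ξ => ?_
    · rw [Real.norm_of_nonneg (diskPoissonKernel_pos hz ξ).le]
      exact (diskPoissonKernel_bounds hz ξ).2
    · have h2 := mul_le_mul_of_nonneg_left (h ξ) (diskPoissonKernel_pos hz ξ).le
      have h3 := mul_le_mul_of_nonneg_right (diskPoissonKernel_bounds hz ξ).2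
        (mul_nonneg (hy0 ξ) hK)
      change _ ≤ diskPoissonKernel z ξ * t + (1 + ‖z‖) / (1 - ‖z‖) * K * y ξ
      linarith
  rw [integral_add hPi (hy.const_mul _), integral_mul_const, integral_const_mul,
    integral_diskPoissonKernel hz, one_mul] at h1
  exact h1

/-- If `∫ exp x_n ≤ 1` and `∫ x_n → 0`, then the Poisson integrals of `x_n` tend to zero. -/
theorem tendsto_integral_diskPoissonKernel_mul {z : ℂ} (hz : ‖z‖ < 1) {x : ℕ → Circle → ℝ}
    (hx : ∀ n, Integrable (x n) circleLebesgue)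
    (he : ∀ n, Integrable (fun ξ => Real.exp (x n ξ)) circleLebesgue)
    (he1 : ∀ n, ∫ ξ, Real.exp (x n ξ) ∂circleLebesgue ≤ 1)
    (hlim : ∀ ε > 0, ∀ᶠ n in atTop, -ε ≤ ∫ ξ, x n ξ ∂circleLebesgue) :
    Tendsto (fun n => ∫ ξ, diskPoissonKernel z ξ * x n ξ ∂circleLebesgue) atTop (𝓝 0) := by
  have hC : 0 < (1 + ‖z‖) / (1 - ‖z‖) := div_pos (by positivity) (by linarith)
  rw [Metric.tendsto_atTop']
  intro ε hε
  set t := ε / 3 with ht_def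
  have ht : 0 < t := by positivity
  have hK1 : 0 < Real.exp t - 1 := by linarith [Real.add_one_lt_exp ht.ne']
  have hK2 : 0 < 1 - Real.exp (-t) := by
    have : Real.exp (-t) < 1 := by simpa using ht
    linarith
  set K := max (Real.exp t - 1)⁻¹ (1 - Real.exp (-t))⁻¹ with hK_def
  have hK : 0 < K := lt_max_of_lt_left (inv_pos.mpr hK1)
  set C := (1 + ‖z‖) / (1 - ‖z‖)
  obtain ⟨n₀, hn₀⟩ := eventually_atTop.mp (hlim (ε / 3 / (C * K)) (by positivity))
  refine ⟨n₀, fun n hn => ?_⟩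
  -- The convexity gap `y` is nonnegative and its integral is at most `-∫ x_n`. Since `±x_n ≤ t + K
  -- y`, the Poisson integral of `±x_n` is at most `t + C K ∫ y ≤ 2ε/3`.
  let y : Circle → ℝ := fun ξ => Real.exp (x n ξ) - 1 - x n ξ
  have hy : Integrable y circleLebesgue := ((he n).sub (integrable_const 1)).sub (hx n)
  have hy0 : ∀ ξ, 0 ≤ y ξ := fun ξ => by
    have := Real.add_one_le_exp (x n ξ)
    change 0 ≤ Real.exp (x n ξ) - 1 - x n ξ
    linarith
  have hyi : ∫ ξ, y ξ ∂circleLebesgue ≤ ε / 3 / (C * K) := by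
    have i1 : Integrable (fun ξ => Real.exp (x n ξ) - 1) circleLebesgue :=
      (he n).sub (integrable_const 1)
    change ∫ ξ, (Real.exp (x n ξ) - 1 - x n ξ) ∂circleLebesgue ≤ _
    rw [integral_sub i1 (hx n), integral_sub (he n) (integrable_const 1)]
    simp only [integral_const, probReal_univ, smul_eq_mul, mul_one]
    have := he1 n
    have := hn₀ n hn.le
    linarith
  have hCK : C * K * ∫ ξ, y ξ ∂circleLebesgue ≤ ε / 3 := by
    have := mul_le_mul_of_nonneg_left hyi (mul_pos hC hK).le
    rwa [mul_div_cancel₀ _ (mul_pos hC hK).ne'] at this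
  have b1 := integral_diskPoissonKernel_mul_le hz (hx n) hy hy0 hK.le (t := t) fun ξ => by
    refine (le_add_of_exp_tangent ht).trans ?_
    rw [div_eq_mul_inv]
    have := mul_le_mul_of_nonneg_left (le_max_left (Real.exp t - 1)⁻¹ (1 - Real.exp (-t))⁻¹) (hy0 ξ)
    exact add_le_add_right this t
  have b2 := integral_diskPoissonKernel_mul_le hz (hx n).neg hy hy0 hK.le (t := t) fun ξ => by
    refine (neg_le_add_of_exp_tangent ht).trans ?_
    rw [div_eq_mul_inv]
    have := mul_le_mul_of_nonneg_left (le_max_right (Real.exp t - 1)⁻¹ (1 - Real.exp (-t))⁻¹) (hy0 ξ)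
    exact add_le_add_right this t
  simp only [Pi.neg_apply, mul_neg, integral_neg] at b2
  rw [Real.dist_eq, sub_zero, abs_lt]
  constructor <;> linarith

end Convergence

/-! ### Convergence of the product and the entropy formula -/

section EntropyFormula

variable {μ : Measure Circle} {f : ℕ → ℂ → ℂ}

theorem IsSchurFamily.norm_lt_one (hμ : IsSzego μ) (h : IsSchurFamily μ f) (n : ℕ) {z : ℂ}
    (hz : ‖z‖ < 1) : ‖f n z‖ < 1 :=
  (h.isSchurPrefix n).norm_lt_one hμ n le_rfl z hz

theorem IsSchurFamily.norm_schurParam_lt (hμ : IsSzego μ) (h : IsSchurFamily μ f) (n : ℕ) :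
    ‖schurParam f n‖ < 1 := h.norm_lt_one hμ n (by simp)

theorem integrable_log_bernsteinWeight {a : ℕ → ℂ} {n : ℕ} (ha : ∀ k < n, ‖a k‖ < 1) :
    Integrable (fun ξ => Real.log (bernsteinWeight a n ξ)) circleLebesgue :=
  integrable_of_continuous _
    ((continuous_bernsteinWeight ha).log fun ξ => (bernsteinWeight_pos ha ξ).ne')

/-- Integrate `log (w_n T) ≤ w_n T - 1` for a trigonometric test function `T` close to `1/w`. Once
`n` exceeds the degrees involved, `∫ w_n T dm = ∫ T dμ`, which is nearly at most one. -/
theorem IsSchurFamily.eventually_integral_log_le (hμ : IsSzego μ) (h : IsSchurFamily μ f) {ε : ℝ}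
    (hε : 0 < ε) :
    ∀ᶠ n in atTop, ∫ ξ, Real.log (bernsteinWeight (schurParam f) n ξ) ∂circleLebesgue ≤
      ∫ ξ, Real.log (density μ ξ) ∂circleLebesgue + ε := by
  have := hμ.isProbabilityMeasure
  obtain ⟨N, p, hpos, h1, h2⟩ := hμ.exists_trigonometric_test_function (half_pos hε)
  filter_upwards [eventually_ge_atTop (max N p.natDegree)] with n hn
  have ha : ∀ k < n, ‖schurParam f k‖ < 1 := fun k _ => h.norm_schurParam_lt hμ k
  have := isProbabilityMeasure_bernsteinMeasure ha
  have hm := ((h.isSchurPrefix n).moment_eq (fun k _ z hz => h.norm_lt_one hμ k hz)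
    fun z hz => (h.norm_lt_one hμ n hz).le).1
  have hc : Continuous fun ξ : Circle => p.eval (ξ : ℂ) * conj (ξ : ℂ) ^ N :=
    (p.continuous.comp continuous_coe_circle).mul (by fun_prop)
  let T : Circle → ℝ := fun ξ => (p.eval (ξ : ℂ) * conj (ξ : ℂ) ^ N).re
  have hT : Continuous T := Complex.continuous_re.comp hc
  have heq : ∫ ξ, T ξ ∂bernsteinMeasure (schurParam f) n = ∫ ξ, T ξ ∂μ := by
    have e := integral_eval_mul_conj_eval_eq μ (bernsteinMeasure (schurParam f) n) hm (p := p)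
      (q := Polynomial.X ^ N) (by have := le_max_right N p.natDegree; omega)
      (by have := le_max_left N p.natDegree; rw [Polynomial.natDegree_X_pow]; omega)
    simp only [Polynomial.eval_pow, Polynomial.eval_X, map_pow] at e
    have r1 := integral_re (𝕜 := ℂ) (integrable_of_continuous μ hc)
    have r2 := integral_re (𝕜 := ℂ)
      (integrable_of_continuous (bernsteinMeasure (schurParam f) n) hc)
    rw [← e] at r2
    exact r2.trans r1.symm
  rw [integral_bernsteinMeasure ha] at heq
  simp only [smul_eq_mul] at heq
  have hw := continuous_bernsteinWeight ha
  have hlT : Continuous fun ξ => Real.log (T ξ) := hT.log fun ξ => (hpos ξ).ne'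
  have i1 : Integrable (fun ξ => bernsteinWeight (schurParam f) n ξ * T ξ) circleLebesgue :=
    integrable_of_continuous _ (hw.mul hT)
  have i2 : Integrable (fun ξ => bernsteinWeight (schurParam f) n ξ * T ξ - 1) circleLebesgue :=
    i1.sub (integrable_const 1)
  have i3 : Integrable (fun ξ => Real.log (T ξ)) circleLebesgue := integrable_of_continuous _ hlT
  have hle : ∫ ξ, Real.log (bernsteinWeight (schurParam f) n ξ) ∂circleLebesgue ≤
      ∫ ξ, (bernsteinWeight (schurParam f) n ξ * T ξ - 1 - Real.log (T ξ)) ∂circleLebesgue := by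
    refine integral_mono (integrable_log_bernsteinWeight ha) (i2.sub i3) fun ξ => ?_
    have hwpos := bernsteinWeight_pos ha ξ
    have hTpos : 0 < T ξ := hpos ξ
    have h3 := Real.log_le_sub_one_of_pos (mul_pos hwpos hTpos)
    rw [Real.log_mul hwpos.ne' hTpos.ne'] at h3
    change Real.log (bernsteinWeight (schurParam f) n ξ) ≤
      bernsteinWeight (schurParam f) n ξ * T ξ - 1 - Real.log (T ξ)
    linarith
  rw [integral_sub i2 i3, integral_sub i1 (integrable_const 1), heq] at hle
  simp only [integral_const, probReal_univ, smul_eq_mul, mul_one] at hle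
  have h1' : ∫ ξ, T ξ ∂μ ≤ 1 + ε / 2 := h1
  have h2' : -∫ ξ, Real.log (density μ ξ) ∂circleLebesgue - ε / 2 ≤
    ∫ ξ, Real.log (T ξ) ∂circleLebesgue := h2
  linarith

/-- The function `1 / w_n = |Φ_n^*|² / S_n` has `μ`-integral one; discarding the singular part can
only lower it. -/
theorem IsSchurFamily.integral_density_div_bernsteinWeight_le (hμ : IsSzego μ)
    (h : IsSchurFamily μ f) (n : ℕ) :
    Integrable (fun ξ => density μ ξ * (bernsteinWeight (schurParam f) n ξ)⁻¹) circleLebesgue ∧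
    ∫ ξ, density μ ξ * (bernsteinWeight (schurParam f) n ξ)⁻¹ ∂circleLebesgue ≤ 1 := by
  have := hμ.isProbabilityMeasure
  have ha : ∀ k < n, ‖schurParam f k‖ < 1 := fun k _ => h.norm_schurParam_lt hμ k
  have hc : Continuous fun ξ => (bernsteinWeight (schurParam f) n ξ)⁻¹ :=
    (continuous_bernsteinWeight ha).inv₀ fun ξ => (bernsteinWeight_pos ha ξ).ne'
  refine ⟨integrable_density_mul hc, (integral_density_mul_le hc fun ξ =>
    (inv_pos.mpr (bernsteinWeight_pos ha ξ)).le).trans_eq ?_⟩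
  simp_rw [bernsteinWeight, inv_div]
  rw [integral_div, (h.isSchurPrefix n).integral_norm_szegoRev
    (fun k _ z hz => h.norm_lt_one hμ k hz) fun z hz => (h.norm_lt_one hμ n hz).le,
    div_self (szegoProd_pos ha).ne']

/-- The Poisson integrals of the logarithms of the Bernstein–Szegő weights converge to that of the
logarithm of the density. -/
theorem IsSchurFamily.tendsto_poissonOfFun_log (hμ : IsSzego μ) (h : IsSchurFamily μ f) {z : ℂ}
    (hz : ‖z‖ < 1) :
    Tendsto (fun n => poissonOfFun (fun ξ => Real.log (bernsteinWeight (schurParam f) n ξ)) z) atTop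
      (𝓝 (poissonOfFun (fun ξ => Real.log (density μ ξ)) z)) := by
  have ha : ∀ n, ∀ k < n, ‖schurParam f k‖ < 1 := fun n k _ => h.norm_schurParam_lt hμ k
  have hwi := fun n => integrable_log_bernsteinWeight (ha n)
  let x : ℕ → Circle → ℝ := fun n ξ =>
    Real.log (density μ ξ) - Real.log (bernsteinWeight (schurParam f) n ξ)
  have hx : ∀ n, Integrable (x n) circleLebesgue := fun n => hμ.integrable_log.sub (hwi n)
  have hexp : ∀ n, (fun ξ => density μ ξ * (bernsteinWeight (schurParam f) n ξ)⁻¹)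
      =ᵐ[circleLebesgue] fun ξ => Real.exp (x n ξ) := by
    intro n
    filter_upwards [hμ.density_pos] with ξ hξ
    rw [Real.exp_sub, Real.exp_log hξ, Real.exp_log (bernsteinWeight_pos (ha n) ξ), div_eq_mul_inv]
  have hI := h.integral_density_div_bernsteinWeight_le hμ
  have key := tendsto_integral_diskPoissonKernel_mul hz hx
    (fun n => (hI n).1.congr (hexp n))
    (fun n => by rw [← integral_congr_ae (hexp n)]; exact (hI n).2)
    (fun ε hε => by
      filter_upwards [h.eventually_integral_log_le hμ hε] with n hn
      rw [integral_sub hμ.integrable_log (hwi n)]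
      linarith)
  have hP := continuous_diskPoissonKernel hz
  have hb : ∀ g : Circle → ℝ, Integrable g circleLebesgue →
      Integrable (fun ξ => diskPoissonKernel z ξ * g ξ) circleLebesgue := fun g hg =>
    hg.bdd_mul (c := (1 + ‖z‖) / (1 - ‖z‖)) hP.aestronglyMeasurable (.of_forall fun ξ => by
      rw [Real.norm_of_nonneg (diskPoissonKernel_pos hz ξ).le]
      exact (diskPoissonKernel_bounds hz ξ).2)
  have hdiff : ∀ n, ∫ ξ, diskPoissonKernel z ξ * x n ξ ∂circleLebesgue =
      poissonOfFun (fun ξ => Real.log (density μ ξ)) z -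
        poissonOfFun (fun ξ => Real.log (bernsteinWeight (schurParam f) n ξ)) z := fun n => by
    rw [poissonOfFun, poissonOfFun, ← integral_sub (hb _ hμ.integrable_log) (hb _ (hwi n))]
    simp_rw [← mul_sub]
    rfl
  simp_rw [hdiff] at key
  simpa using key.const_sub (poissonOfFun (fun ξ => Real.log (density μ ξ)) z)

theorem IsSchurFamily.tendsto_norm_szegoRev (hμ : IsSzego μ) (h : IsSchurFamily μ f) {z : ℂ}
    (hz : ‖z‖ < 1) :
    Tendsto (fun n => ‖(szegoRev (schurParam f) n).eval z‖ ^ 2 / szegoProd (schurParam f) n) atTop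
      (𝓝 (Real.exp (-poissonOfFun (fun ξ => Real.log (density μ ξ)) z))) := by
  have ha : ∀ n, ∀ k < n, ‖schurParam f k‖ < 1 := fun n k _ => h.norm_schurParam_lt hμ k
  refine ((Real.continuous_exp.tendsto _).comp (h.tendsto_poissonOfFun_log hμ hz).neg).congr
    fun n => ?_
  have h0 := norm_pos_iff.mpr (norm_szegoPoly_le (ha n) hz.le).1
  have hp := szegoProd_pos (ha n)
  rw [Function.comp_apply, poissonOfFun_log_bernsteinWeight (ha n) hz, neg_sub, Real.exp_sub,
    Real.exp_log hp, two_mul, Real.exp_add, Real.exp_log h0, sq]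

/-- The `n`-th factor `(1 - |z f_n(z)|²) / (1 - |f_n(z)|²)` of the entropy product. -/
def schurFactor (f : ℕ → ℂ → ℂ) (z : ℂ) (n : ℕ) : ℝ :=
  (1 - ‖z * f n z‖ ^ 2) / (1 - ‖f n z‖ ^ 2)

theorem one_add_le_schurFactor {n : ℕ} {z : ℂ} (hz : ‖z‖ < 1) (hf : ‖f n z‖ < 1) :
    1 + (1 - ‖z‖ ^ 2) * ‖f n z‖ ^ 2 ≤ schurFactor f z n := by
  have h1 : 0 < 1 - ‖f n z‖ ^ 2 := by nlinarith [norm_nonneg (f n z)]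
  have h2 : 0 ≤ 1 - ‖z‖ ^ 2 := by nlinarith [norm_nonneg z]
  rw [schurFactor, le_div_iff₀ h1, norm_mul]
  -- The discarded term: with `s = |f_n(z)|²`, `(1 + (1 - |z|²) s)(1 - s) = 1 - |z|² s - (1 - |z|²)
  -- s²`.
  have := mul_nonneg h2 (pow_nonneg (norm_nonneg (f n z)) 4)
  nlinarith

theorem IsSchurFamily.prod_schurFactor (hμ : IsSzego μ) (h : IsSchurFamily μ f) {z : ℂ}
    (hz : ‖z‖ < 1) (n : ℕ) :
    (∏ k ∈ Finset.range n, schurFactor f z k) * (1 - ‖z * f n z‖ ^ 2) * szegoProd (schurParam f) n =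
      poissonOfMeasure μ z * ‖(szegoRev (schurParam f) n).eval z -
        z * (szegoPoly (schurParam f) n).eval z * f n z‖ ^ 2 := by
  have := hμ.isProbabilityMeasure
  have hp := h.isSchurPrefix n
  obtain ⟨c, h1, -, h3⟩ := hp.exists_multiplier (fun k _ z hz => h.norm_lt_one hμ k hz) hz
  have hu := hp.norm_mul_apply_zero_lt_one hz
  have hne : ‖1 - z * f 0 z‖ ≠ 0 := by
    intro h0
    rw [norm_eq_zero, sub_eq_zero] at h0
    rw [← h0, norm_one] at hu
    exact lt_irrefl _ hu
  have hP : poissonOfMeasure μ z = (1 - ‖z * f 0 z‖ ^ 2) / ‖1 - z * f 0 z‖ ^ 2 := by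
    rw [← re_herglotz μ hz, ← hp.relation z hz, re_cayley]
  rw [← h1, hP, norm_mul (1 - z * f 0 z)]
  simp only [schurFactor]
  rw [h3]
  field_simp

/-- With `r = |z f_n(z)|`, the bound `|Φ_n| ≤ |Φ_n^*|` places `|Φ_n^* - z Φ_n f_n|` between `(1 -
r)|Φ_n^*|` and `(1 + r)|Φ_n^*|`; one of the factors of `1 - r²` then cancels. -/
theorem IsSchurFamily.prod_schurFactor_bounds (hμ : IsSzego μ) (h : IsSchurFamily μ f) {z : ℂ}
    (hz : ‖z‖ < 1) (n : ℕ) :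
    poissonOfMeasure μ z * (‖(szegoRev (schurParam f) n).eval z‖ ^ 2 / szegoProd (schurParam f) n) *
        ((1 - ‖z * f n z‖) / (1 + ‖z * f n z‖)) ≤ ∏ k ∈ Finset.range n, schurFactor f z k ∧
      ∏ k ∈ Finset.range n, schurFactor f z k ≤
        poissonOfMeasure μ z *
          (‖(szegoRev (schurParam f) n).eval z‖ ^ 2 / szegoProd (schurParam f) n) *
          ((1 + ‖z * f n z‖) / (1 - ‖z * f n z‖)) := by
  have := hμ.isProbabilityMeasure
  have ha : ∀ k < n, ‖schurParam f k‖ < 1 := fun k _ => h.norm_schurParam_lt hμ k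
  have hprod := h.prod_schurFactor hμ hz n
  have hS := szegoProd_pos ha
  have hPpos := poissonOfMeasure_pos μ hz
  obtain ⟨h0, hle⟩ := norm_szegoPoly_le ha hz.le
  have hr1 : ‖z * f n z‖ < 1 := by
    rw [norm_mul]
    exact (mul_le_of_le_one_right (norm_nonneg _) (h.norm_lt_one hμ n hz).le).trans_lt hz
  have hr0 := norm_nonneg (z * f n z)
  set r := ‖z * f n z‖ with hr
  set R := ‖(szegoRev (schurParam f) n).eval z‖ with hR
  set D := ‖(szegoRev (schurParam f) n).eval z -
    z * (szegoPoly (schurParam f) n).eval z * f n z‖ with hD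
  set P := ∏ k ∈ Finset.range n, schurFactor f z k
  have hR0 : 0 ≤ R := norm_nonneg _
  have hsmall : ‖z * (szegoPoly (schurParam f) n).eval z * f n z‖ ≤ R * r := by
    rw [mul_right_comm, norm_mul, ← hr, mul_comm]
    gcongr
  have hD1 : R * (1 - r) ≤ D := by
    have := norm_sub_norm_le ((szegoRev (schurParam f) n).eval z)
      (z * (szegoPoly (schurParam f) n).eval z * f n z)
    linarith
  have hD2 : D ≤ R * (1 + r) := by
    have := norm_sub_le ((szegoRev (schurParam f) n).eval z)
      (z * (szegoPoly (schurParam f) n).eval z * f n z)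
    linarith
  have hm : 0 < 1 - r := by linarith
  have hp : 0 < 1 + r := by linarith
  have hPeq : P = poissonOfMeasure μ z * D ^ 2 / ((1 - r) * (1 + r) * szegoProd (schurParam f) n) := by
    rw [eq_div_iff (by positivity), ← hprod]; ring
  rw [hPeq]
  constructor
  · have e : poissonOfMeasure μ z * (R ^ 2 / szegoProd (schurParam f) n) * ((1 - r) / (1 + r)) =
        poissonOfMeasure μ z * (R * (1 - r)) ^ 2 /
          ((1 - r) * (1 + r) * szegoProd (schurParam f) n) := by
      field_simp
    rw [e]
    gcongr
  · have e : poissonOfMeasure μ z * (R ^ 2 / szegoProd (schurParam f) n) * ((1 + r) / (1 - r)) =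
        poissonOfMeasure μ z * (R * (1 + r)) ^ 2 /
          ((1 - r) * (1 + r) * szegoProd (schurParam f) n) := by
      field_simp
    rw [e]
    gcongr

/-- The logarithms are nonnegative, so bounded partial products suffice. At this stage only the
crude bound `|z f_n(z)| ≤ |z|` is at hand; convergence of `f_n(z)` to zero is deduced from the
summability. -/
theorem IsSchurFamily.summable_log_schurFactor (hμ : IsSzego μ) (h : IsSchurFamily μ f) {z : ℂ}
    (hz : ‖z‖ < 1) : Summable fun n => Real.log (schurFactor f z n) := by
  have := hμ.isProbabilityMeasure
  have hf : ∀ n, 1 ≤ schurFactor f z n := fun n => by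
    have h1 := one_add_le_schurFactor hz (h.norm_lt_one hμ n hz)
    have h2 : 0 ≤ 1 - ‖z‖ ^ 2 := by nlinarith [norm_nonneg z]
    have := mul_nonneg h2 (sq_nonneg ‖f n z‖)
    linarith
  obtain ⟨C, hC⟩ := (h.tendsto_norm_szegoRev hμ hz).bddAbove_range
  have hPpos := poissonOfMeasure_pos μ hz
  have hm : 0 < 1 - ‖z‖ := by linarith
  refine summable_of_sum_range_le (fun n => Real.log_nonneg (hf n)) (c := Real.log
    (poissonOfMeasure μ z * C * ((1 + ‖z‖) / (1 - ‖z‖)))) fun n => ?_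
  rw [← Real.log_prod fun k _ => (one_pos.trans_le (hf k)).ne']
  refine Real.log_le_log (Finset.prod_pos fun k _ => one_pos.trans_le (hf k))
    ((h.prod_schurFactor_bounds hμ hz n).2.trans ?_)
  have hr : ‖z * f n z‖ ≤ ‖z‖ := by
    rw [norm_mul]; exact mul_le_of_le_one_right (norm_nonneg _) (h.norm_lt_one hμ n hz).le
  have hS := szegoProd_pos fun k (_ : k < n) => h.norm_schurParam_lt hμ k
  have hCn : ‖(szegoRev (schurParam f) n).eval z‖ ^ 2 / szegoProd (schurParam f) n ≤ C :=
    hC ⟨n, rfl⟩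
  have hC0 : 0 ≤ C := le_trans (by positivity) hCn
  have hq : 0 ≤ (1 + ‖z * f n z‖) / (1 - ‖z * f n z‖) := div_nonneg (by positivity) (by linarith)
  gcongr

theorem IsSchurFamily.tendsto_zero (hμ : IsSzego μ) (h : IsSchurFamily μ f) {z : ℂ}
    (hz : ‖z‖ < 1) : Tendsto (fun n => ‖f n z‖) atTop (𝓝 0) := by
  have h1 := (h.summable_log_schurFactor hμ hz).tendsto_atTop_zero
  have hz2 : 0 < 1 - ‖z‖ ^ 2 := by nlinarith [norm_nonneg z]
  have h2 : Tendsto (fun n => schurFactor f z n) atTop (𝓝 1) := by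
    have := (Real.continuous_exp.tendsto _).comp h1
    rw [Real.exp_zero] at this
    refine this.congr fun n => Real.exp_log ?_
    have h3 := one_add_le_schurFactor hz (h.norm_lt_one hμ n hz)
    have := mul_nonneg hz2.le (sq_nonneg ‖f n z‖)
    linarith
  have h3 : Tendsto (fun n => (schurFactor f z n - 1) / (1 - ‖z‖ ^ 2)) atTop (𝓝 0) := by
    simpa using (h2.sub_const 1).div_const (1 - ‖z‖ ^ 2)
  have h4 : Tendsto (fun n => ‖f n z‖ ^ 2) atTop (𝓝 0) :=
    squeeze_zero (fun n => sq_nonneg _) (fun n => by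
      rw [le_div_iff₀ hz2]
      linarith [one_add_le_schurFactor hz (h.norm_lt_one hμ n hz)]) h3
  have h5 := h4.sqrt
  simpa [Real.sqrt_sq (norm_nonneg _)] using h5

theorem IsSchurFamily.tendsto_prod_schurFactor (hμ : IsSzego μ) (h : IsSchurFamily μ f) {z : ℂ}
    (hz : ‖z‖ < 1) :
    Tendsto (fun n => ∏ k ∈ Finset.range n, schurFactor f z k) atTop
      (𝓝 (poissonOfMeasure μ z *
        Real.exp (-poissonOfFun (fun ξ => Real.log (density μ ξ)) z))) := by
  have hr : Tendsto (fun n => ‖z * f n z‖) atTop (𝓝 0) := by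
    simpa using (h.tendsto_zero hμ hz).const_mul ‖z‖
  have hQ := (h.tendsto_norm_szegoRev hμ hz).const_mul (poissonOfMeasure μ z)
  have hlo : Tendsto (fun n => (1 - ‖z * f n z‖) / (1 + ‖z * f n z‖)) atTop (𝓝 1) := by
    have := (hr.const_sub 1).div (hr.const_add 1) (by norm_num)
    rwa [sub_zero, add_zero, div_one] at this
  have hhi : Tendsto (fun n => (1 + ‖z * f n z‖) / (1 - ‖z * f n z‖)) atTop (𝓝 1) := by
    have := (hr.const_add 1).div (hr.const_sub 1) (by norm_num)
    rwa [sub_zero, add_zero, div_one] at this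
  have h1 := hQ.mul hlo
  have h2 := hQ.mul hhi
  rw [mul_one] at h1 h2
  exact tendsto_of_tendsto_of_tendsto_of_le_of_le h1 h2
    (fun n => (h.prod_schurFactor_bounds hμ hz n).1) fun n => (h.prod_schurFactor_bounds hμ hz n).2

end EntropyFormula

end SzegoEntropy

end

theorem theorem1 (μ : MeasureTheory.Measure Circle) (hμ : SzegoEntropy.IsSzego μ) :
    (∃ f : ℕ → ℂ → ℂ, SzegoEntropy.IsSchurFamily μ f) ∧
    ∀ f : ℕ → ℂ → ℂ, SzegoEntropy.IsSchurFamily μ f →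
      ∀ z ∈ Metric.ball (0 : ℂ) 1,
        (∀ n, ‖f n z‖ < 1) ∧
        Multipliable (fun n => (1 - ‖z * f n z‖ ^ 2) / (1 - ‖f n z‖ ^ 2)) ∧
        SzegoEntropy.entropy μ z =
          Real.log (∏' n, (1 - ‖z * f n z‖ ^ 2) / (1 - ‖f n z‖ ^ 2)) := by
  refine ⟨⟨_, SzegoEntropy.isSchurFamily_schurFamily hμ⟩, fun f h z hz => ?_⟩
  have hz : ‖z‖ < 1 := by simpa using hz
  have := hμ.isProbabilityMeasure
  have hlt : ∀ n, ‖f n z‖ < 1 := fun n => h.norm_lt_one hμ n hz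
  have hpos : ∀ n, 0 < SzegoEntropy.schurFactor f z n := fun n => by
    have h1 := SzegoEntropy.one_add_le_schurFactor hz (hlt n)
    have h2 : 0 ≤ 1 - ‖z‖ ^ 2 := by nlinarith [norm_nonneg z]
    have := mul_nonneg h2 (sq_nonneg ‖f n z‖)
    linarith
  have hmul : Multipliable (SzegoEntropy.schurFactor f z) :=
    Real.multipliable_of_summable_log hpos (h.summable_log_schurFactor hμ hz)
  refine ⟨hlt, hmul, ?_⟩
  have hprod := tendsto_nhds_unique hmul.hasProd.tendsto_prod_nat
    (h.tendsto_prod_schurFactor hμ hz)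
  change _ = Real.log (∏' n, SzegoEntropy.schurFactor f z n)
  rw [hprod, Real.log_mul (SzegoEntropy.poissonOfMeasure_pos μ hz).ne' (Real.exp_pos _).ne',
    Real.log_exp, SzegoEntropy.entropy, sub_eq_add_neg]
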